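/- Let $M$ be a compact, connected and simply connected smooth $2$-manifold with boundary (convex corners on the boundary are allowed), and let $z: M\to\mathbb{R}^2=\mathbb{C}$ be a smooth immersion (for example the inclusion of a planar domain; in general a "planar domain with self-overlap"). Orient $M$ so that $z$ is orientation-preserving. For a smooth map $f: M\to\mathbb{C}$ define $f_z, f_{\bar z}: M\to\mathbb{C}$ by $df=f_z\,dz+f_{\bar z}\,d\bar z$. Let $V:(0,\infty)\to\mathbb{R}$ be a smooth, strictly convex function with $V(1)=0$ and $V(x)>0$ for $x\neq 1$, and such that $V'(x)\sqrt{x}$ is bounded near $x=0$. Define $$E_V(f)=\frac12\int_M \left(V(|f_z|^2)+|f_{\bar z}|^2\right),$$ where the integral is taken with respect to the area form $\frac{i}{2}\,dz\wedge d\bar z$ induced on $M$ by $z$. Let $f: M\to\mathbb{C}$ be a smooth orientation-preserving immersion that is a critical point of $E_V$ with respect to all variations, i.e. $\frac{d}{dt}\big|_{t=0}E_V(f+t\dot f)=0$ for every function $\dot f: M\to\mathbb{C}$ that is smooth up to the boundary, with no condition on its boundary values. Suppose that $1+V'(|f_z|^2)>0$ on all of $M$. Then $f$ is an orientation-preserving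 Euclidean motion: there are $a,b\in\mathbb{C}$ with $|a|=1$ and $f=a\,z+b$ on $M$. -/

import Mathlib

open MeasureTheory Set Filter Topology Asymptotics
open scoped Manifold ContDiff ComplexConjugate

namespace FreeBoundary

/-- The admissible functions `V : (0, ∞) → ℝ`: smooth, strictly convex, with the value zero at
`x = 1` as their only minimum, and with `V'(x) √x` bounded near `x = 0`. Only the values of `V`
on `(0, ∞)` matter. -/
structure IsElasticPotential (V : ℝ → ℝ) : Prop where
  smooth : ContDiffOn ℝ ∞ V (Ioi 0)
  strictConvex : StrictConvexOn ℝ (Ioi 0) V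
  map_one : V 1 = 0
  pos_of_ne_one : ∀ x : ℝ, 0 < x → x ≠ 1 → 0 < V x
  deriv_isBigO : (fun x : ℝ => deriv V x * √x) =O[𝓝[>] 0] (fun _ => (1 : ℝ))

section Wirtinger

variable {H : Type*} [TopologicalSpace H] (I : ModelWithCorners ℝ (EuclideanSpace ℝ (Fin 2)) H)
  {M : Type*} [TopologicalSpace M] [ChartedSpace H M]

/-- The differential of `f : M → ℂ` at `x`, as a real-linear map from the tangent space to `ℂ`. -/
noncomputable def differential (f : M → ℂ) (x : M) : EuclideanSpace ℝ (Fin 2) →L[ℝ] ℂ :=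
  mfderiv I 𝓘(ℝ, ℂ) f x

/-- A smooth immersion of the surface `M` (possibly with boundary) into the plane: a map that is
smooth up to the boundary and whose differential is injective at every point. -/
structure IsPlanarImmersion (f : M → ℂ) : Prop where
  smooth : ContMDiff I 𝓘(ℝ, ℂ) ∞ f
  injective_differential : ∀ x : M, Function.Injective (differential I f x)

/-- The differential of `f` at `x`, read through the immersion `z`: the real-linear map
`df ∘ (dz)⁻¹ : ℂ → ℂ`. -/
noncomputable def relDeriv (z f : M → ℂ) (x : M) : ℂ →L[ℝ] ℂ :=
  (differential I f x).comp (differential I z x).inverse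

/-- `f_z = (f_x - i f_y) / 2`, the derivatives being taken with respect to the coordinate `z`. -/
noncomputable def dz (z f : M → ℂ) (x : M) : ℂ :=
  (relDeriv I z f x 1 - Complex.I * relDeriv I z f x Complex.I) / 2

/-- `f_z̄ = (f_x + i f_y) / 2`, the derivatives being taken with respect to the coordinate `z`. -/
noncomputable def dzbar (z f : M → ℂ) (x : M) : ℂ :=
  (relDeriv I z f x 1 + Complex.I * relDeriv I z f x Complex.I) / 2

theorem inverse_differential_apply {z : M → ℂ} {x : M}
    (hz : Function.Injective (differential I z x)) (v : EuclideanSpace ℝ (Fin 2)) :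
    (differential I z x).inverse (differential I z x v) = v := by
  have key : ∀ L : EuclideanSpace ℝ (Fin 2) →L[ℝ] ℂ, Function.Injective L →
      ∀ v, L.inverse (L v) = v := by
    intro L hL v
    have hfr : Module.finrank ℝ (EuclideanSpace ℝ (Fin 2)) = Module.finrank ℝ ℂ := by simp
    let e : EuclideanSpace ℝ (Fin 2) ≃L[ℝ] ℂ :=
      (LinearEquiv.ofInjectiveOfFinrankEq L.toLinearMap hL hfr).toContinuousLinearEquiv
    have he : (e : EuclideanSpace ℝ (Fin 2) →L[ℝ] ℂ) = L := by
      ext v; rfl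
    rw [← he, ContinuousLinearMap.inverse_equiv]
    simp
  exact key _ hz v

/-- The defining decomposition `df = f_z dz + f_z̄ dz̄`. -/
theorem differential_eq_dz_add_dzbar {z : M → ℂ} (f : M → ℂ) {x : M}
    (hz : Function.Injective (differential I z x)) (v : EuclideanSpace ℝ (Fin 2)) :
    differential I f x v = dz I z f x * differential I z x v
      + dzbar I z f x * conj (differential I z x v) := by
  have h1 : differential I f x v = relDeriv I z f x (differential I z x v) :=
    (congrArg (differential I f x) (inverse_differential_apply I hz v)).symm
  have key : ∀ (A : ℂ →L[ℝ] ℂ) (w : ℂ), A w =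
      (A 1 - Complex.I * A Complex.I) / 2 * w + (A 1 + Complex.I * A Complex.I) / 2 * conj w := by
    intro A w
    have hw : A w = (w.re : ℂ) * A 1 + (w.im : ℂ) * A Complex.I := by
      have : w = w.re • (1 : ℂ) + w.im • Complex.I := by
        simp [Complex.re_add_im]
      conv_lhs => rw [this]
      rw [map_add, map_smul, map_smul, Complex.real_smul, Complex.real_smul]
    have e1 : w + conj w = 2 * (w.re : ℂ) := by rw [Complex.add_conj]; push_cast; ring
    have e2 : w - conj w = 2 * (w.im : ℂ) * Complex.I := by
      rw [Complex.sub_conj]; push_cast; ring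
    rw [hw]
    linear_combination (-(A 1) / 2) * e1 + (Complex.I * A Complex.I / 2) * e2
      + (w.im : ℂ) * A Complex.I * Complex.I_sq
  rw [h1]
  exact key _ _

/-- `f` is an orientation-preserving immersion, where `M` carries the orientation for which the
immersion `z` is orientation-preserving. -/
structure IsOrientationPreservingImmersion (z f : M → ℂ) : Prop where
  immersion : IsPlanarImmersion I f
  det_pos : ∀ x : M, 0 < (relDeriv I z f x).det

end Wirtinger

/-- The area measure `(i/2) dz ∧ dz̄` induced on `M` by an immersion `z : M → ℂ`: the area in the
plane, counted with the number of points of `M` that lie above each point of the plane,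
`A ↦ ∫ #(A ∩ z⁻¹(w)) dw`. It is the Borel measure on `M` for which `z` is locally
area-preserving, see `pullbackArea_of_injOn`. -/
noncomputable def pullbackArea {M : Type*} [MeasurableSpace M] (z : M → ℂ) : Measure M :=
  Measure.bind (volume : Measure ℂ) (fun w => Measure.count.restrict (z ⁻¹' {w}))

section Area

variable {M : Type*} [TopologicalSpace M] [PolishSpace M] [MeasurableSpace M] [BorelSpace M]

theorem measurable_count_fiber {z : M → ℂ} (hz : Continuous z)
    (hinj : ∀ x, ∃ U ∈ 𝓝 x, InjOn z U) :
    Measurable (fun w : ℂ => (Measure.count : Measure M).restrict (z ⁻¹' {w})) := by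
  choose U hU hUi using fun x => hinj x
  obtain ⟨s, hs, hcov⟩ := TopologicalSpace.countable_cover_nhds (fun x => interior_mem_nhds.2 (hU x))
  have hmeas : ∀ A : Set M, MeasurableSet A → InjOn z A →
      Measurable (fun w : ℂ => (Measure.count : Measure M) (A ∩ z ⁻¹' {w})) := by
    intro A hA hAi
    have himg : MeasurableSet (z '' A) := hA.image_of_continuousOn_injOn hz.continuousOn hAi
    have : (fun w : ℂ => (Measure.count : Measure M) (A ∩ z ⁻¹' {w}))
        = (z '' A).indicator (fun _ => 1) := by
      funext w
      by_cases hw : w ∈ z '' A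
      · obtain ⟨a, ha, rfl⟩ := hw
        have : A ∩ z ⁻¹' {z a} = {a} := by
          ext b
          constructor
          · rintro ⟨hb, hb'⟩
            exact hAi hb ha hb'
          · rintro rfl
            exact ⟨ha, rfl⟩
        rw [this, indicator_of_mem (mem_image_of_mem z ha), Measure.count_singleton]
      · have : A ∩ z ⁻¹' {w} = ∅ := by
          ext b
          simp only [mem_inter_iff, mem_preimage, mem_singleton_iff, mem_empty_iff_false,
            iff_false, not_and]
          exact fun hb hb' => hw ⟨b, hb, hb'⟩
        rw [this, indicator_of_notMem hw, measure_empty]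
    rw [this]
    exact measurable_const.indicator himg
  refine Measure.measurable_of_measurable_coe _ fun A hA => ?_
  rcases isEmpty_or_nonempty M with hM | hM
  · have : A = ∅ := Subsingleton.elim _ _
    subst this
    simp
  have hsne : s.Nonempty := by
    by_contra h
    rw [not_nonempty_iff_eq_empty] at h
    subst h
    simp only [mem_empty_iff_false, iUnion_of_empty, iUnion_empty] at hcov
    exact empty_ne_univ hcov
  obtain ⟨e, he⟩ := hs.exists_eq_range hsne
  let C : ℕ → Set M := fun n => interior (U (e n))
  have hC : ⋃ n, C n = univ := by
    rw [← hcov, he, biUnion_range]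
  have hCm : ∀ n, MeasurableSet (disjointed C n) :=
    MeasurableSet.disjointed fun n => isOpen_interior.measurableSet
  have hCi : ∀ n, InjOn z (disjointed C n) := fun n =>
    (hUi (e n)).mono ((disjointed_subset C n).trans interior_subset)
  have hsum : ∀ w, (Measure.count : Measure M).restrict (z ⁻¹' {w}) A
      = ∑' n, (Measure.count : Measure M) ((A ∩ disjointed C n) ∩ z ⁻¹' {w}) := by
    intro w
    have hw : MeasurableSet (z ⁻¹' {w}) := hz.measurable (measurableSet_singleton w)
    rw [Measure.restrict_apply hA, ← measure_iUnion]
    · congr 1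
      rw [← iUnion_inter, ← inter_iUnion, iUnion_disjointed, hC, inter_univ]
    · intro i j hij
      exact ((disjoint_disjointed C hij).mono inter_subset_right inter_subset_right).mono
        inter_subset_left inter_subset_left
    · exact fun n => (hA.inter (hCm n)).inter hw
  simp_rw [hsum]
  exact Measurable.tsum fun n =>
    hmeas _ (hA.inter (hCm n)) ((hCi n).mono inter_subset_right)

/-- A continuous locally injective map `z` preserves the area of every Borel set on which it is
injective, when `M` carries the measure `pullbackArea z`. -/
theorem pullbackArea_of_injOn {z : M → ℂ} (hz : Continuous z)
    (hinj : ∀ x, ∃ U ∈ 𝓝 x, InjOn z U) {A : Set M} (hA : MeasurableSet A) (hAi : InjOn z A) :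
    pullbackArea z A = volume (z '' A) := by
  rw [pullbackArea, Measure.bind_apply hA (measurable_count_fiber hz hinj).aemeasurable,
    ← lintegral_indicator_one (hA.image_of_continuousOn_injOn hz.continuousOn hAi)]
  congr 1
  funext w
  rw [Measure.restrict_apply hA]
  by_cases hw : w ∈ z '' A
  · obtain ⟨a, ha, rfl⟩ := hw
    have : A ∩ z ⁻¹' {z a} = {a} := by
      ext b
      constructor
      · rintro ⟨hb, hb'⟩
        exact hAi hb ha hb'
      · rintro rfl
        exact ⟨ha, rfl⟩
    rw [this, indicator_of_mem (mem_image_of_mem z ha), Measure.count_singleton]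
    rfl
  · have : A ∩ z ⁻¹' {w} = ∅ := by
      ext b
      simp only [mem_inter_iff, mem_preimage, mem_singleton_iff, mem_empty_iff_false,
        iff_false, not_and]
      exact fun hb hb' => hw ⟨b, hb, hb'⟩
    rw [this, indicator_of_notMem hw, measure_empty]

end Area

section Energy

variable {H : Type*} [TopologicalSpace H] (I : ModelWithCorners ℝ (EuclideanSpace ℝ (Fin 2)) H)
  {M : Type*} [TopologicalSpace M] [ChartedSpace H M] [MeasurableSpace M]

/-- The elastic energy `E_V(f) = ½ ∫_M V(|f_z|²) + |f_z̄|²`. -/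
noncomputable def elasticEnergy (V : ℝ → ℝ) (z f : M → ℂ) : ℝ :=
  (1 / 2) * ∫ x, (V (‖dz I z f x‖ ^ 2) + ‖dzbar I z f x‖ ^ 2) ∂(pullbackArea z)

/-- `f` is critical for `E_V` with respect to all variations: for every `h` that is smooth on `M`
up to the boundary (with no condition on the boundary values), the derivative of
`t ↦ E_V(f + t h)` at `t = 0` is zero. -/
def IsCriticalForAllVariations (V : ℝ → ℝ) (z f : M → ℂ) : Prop :=
  ∀ h : M → ℂ, ContMDiff I 𝓘(ℝ, ℂ) ∞ h →
    HasDerivAt (fun t : ℝ => elasticEnergy I V z (fun x => f x + (t : ℂ) * h x)) 0 0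

end Energy

end FreeBoundary

/-! Criticality says that `∫ conj(V' f_z) h_z + conj(f_z̄) h_z̄ = 0` for every smooth `h`, with `V'`
taken at `|f_z|²` (`integral_first_variation_eq_zero`). Test functions supported in the interior
give the Euler-Lagrange equation `(V' f_z)_z̄ + (f_z̄)_z = 0` (`dzbar_add_dz_eq_zero`). As mixed
derivatives commute, this says that `φ = (1 + V') f_z` is holomorphic with respect to `z`.

The free boundary allows test functions that do not vanish on the boundary, in particular
holomorphic ones. The function `φ` has no zeros, because `1 + V' > 0` and an orientation-preserving
immersion has `f_z ≠ 0`. On a simply connected surface it therefore has a holomorphic logarithm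
(`exists_smooth_log`), and `φ log φ` has a primitive `h` (`exists_primitive`). For this `h` the term
with `h_z̄` drops out, and the real part of the first variation is the integral of `(1 + V') |f_z|²
· V' · log |φ|`. By convexity, `V'` and `log |φ|` are both negative when `|f_z| < 1` and both
positive when `|f_z| > 1` (`deriv_mul_log_nonneg`). So the integrand is nonnegative, hence zero
(`eq_zero_of_integral_eq_zero`), and `|f_z| = 1` everywhere.

Now `V' = 0`, and `log φ` is holomorphic and purely imaginary, so `f_z = φ` is a constant of modulus
one. The variation `h = f` leaves `∫ |f_z̄|² = 0`. Hence `df = a dz` with `|a| = 1`. -/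

namespace FreeBoundary

/-! ### Wirtinger coefficients of real-linear maps of the plane -/

section RealLinear

/-- The coefficient of `dz` in a real-linear map of the plane. -/
noncomputable def linDz : (ℂ →L[ℝ] ℂ) →L[ℝ] ℂ :=
  (1 / 2 : ℝ) • (ContinuousLinearMap.apply ℝ ℂ (1 : ℂ)
    - (ContinuousLinearMap.mul ℝ ℂ Complex.I).comp (ContinuousLinearMap.apply ℝ ℂ Complex.I))

/-- The coefficient of `dz̄` in a real-linear map of the plane. -/
noncomputable def linDzbar : (ℂ →L[ℝ] ℂ) →L[ℝ] ℂ :=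
  (1 / 2 : ℝ) • (ContinuousLinearMap.apply ℝ ℂ (1 : ℂ)
    + (ContinuousLinearMap.mul ℝ ℂ Complex.I).comp (ContinuousLinearMap.apply ℝ ℂ Complex.I))

theorem linDz_apply (A : ℂ →L[ℝ] ℂ) : linDz A = (A 1 - Complex.I * A Complex.I) / 2 := by
  simp [linDz]; ring

theorem linDzbar_apply (A : ℂ →L[ℝ] ℂ) : linDzbar A = (A 1 + Complex.I * A Complex.I) / 2 := by
  simp [linDzbar]; ring

theorem apply_eq_linDz_add_linDzbar (A : ℂ →L[ℝ] ℂ) (w : ℂ) :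
    A w = linDz A * w + linDzbar A * conj w := by
  have hw : A w = (w.re : ℂ) * A 1 + (w.im : ℂ) * A Complex.I := by
    have : w = w.re • (1 : ℂ) + w.im • Complex.I := by
      simp [Complex.re_add_im]
    conv_lhs => rw [this]
    rw [map_add, map_smul, map_smul, Complex.real_smul, Complex.real_smul]
  have e1 : w + conj w = 2 * (w.re : ℂ) := by rw [Complex.add_conj]; push_cast; ring
  have e2 : w - conj w = 2 * (w.im : ℂ) * Complex.I := by
    rw [Complex.sub_conj]; push_cast; ring
  rw [hw, linDz_apply, linDzbar_apply]
  linear_combination (-(A 1) / 2) * e1 + (Complex.I * A Complex.I / 2) * e2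
    + (w.im : ℂ) * A Complex.I * Complex.I_sq

theorem linDz_mul_smul (c : ℂ) (A : ℂ →L[ℝ] ℂ) : linDz (c • A) = c * linDz A := by
  simp [linDz_apply]; ring

theorem linDzbar_mul_smul (c : ℂ) (A : ℂ →L[ℝ] ℂ) : linDzbar (c • A) = c * linDzbar A := by
  simp [linDzbar_apply]; ring

/-- This turns preservation of orientation into the inequality `|f_z| > |f_z̄|`. -/
theorem det_eq_normSq_sub_normSq (A : ℂ →L[ℝ] ℂ) :
    A.det = ‖linDz A‖ ^ 2 - ‖linDzbar A‖ ^ 2 := by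
  have h : A.det = (A 1).re * (A Complex.I).im - (A Complex.I).re * (A 1).im := by
    have : A.det = LinearMap.det (A : ℂ →ₗ[ℝ] ℂ) := rfl
    rw [this, ← LinearMap.det_toMatrix Complex.basisOneI, Matrix.det_fin_two]
    simp [LinearMap.toMatrix_apply]
  rw [h, linDz_apply, linDzbar_apply, ← Complex.normSq_eq_norm_sq, ← Complex.normSq_eq_norm_sq]
  simp [Complex.normSq_apply]
  ring

theorem isInvertible_of_injective {L : EuclideanSpace ℝ (Fin 2) →L[ℝ] ℂ}
    (hL : Function.Injective L) : L.IsInvertible := by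
  have hfr : Module.finrank ℝ (EuclideanSpace ℝ (Fin 2)) = Module.finrank ℝ ℂ := by simp
  exact ⟨(LinearEquiv.ofInjectiveOfFinrankEq L.toLinearMap hL hfr).toContinuousLinearEquiv, by
    ext v; rfl⟩

end RealLinear

/-! ### Differentiation relative to the immersion, up to the boundary -/

section Calculus

variable {H : Type*} [TopologicalSpace H] {I : ModelWithCorners ℝ (EuclideanSpace ℝ (Fin 2)) H}
  {M : Type*} [TopologicalSpace M] [ChartedSpace H M]

theorem dz_eq_linDz (z f : M → ℂ) (x : M) : dz I z f x = linDz (relDeriv I z f x) :=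
  (linDz_apply _).symm

theorem dzbar_eq_linDzbar (z f : M → ℂ) (x : M) : dzbar I z f x = linDzbar (relDeriv I z f x) :=
  (linDzbar_apply _).symm

theorem IsPlanarImmersion.isInvertible {z : M → ℂ} (hz : IsPlanarImmersion I z) (x : M) :
    (differential I z x).IsInvertible :=
  isInvertible_of_injective (hz.injective_differential x)

theorem relDeriv_apply_differential {z : M → ℂ} (hz : IsPlanarImmersion I z) (f : M → ℂ) (x : M)
    (v : EuclideanSpace ℝ (Fin 2)) :
    relDeriv I z f x (differential I z x v) = differential I f x v :=
  congrArg (differential I f x) (inverse_differential_apply I (hz.injective_differential x) v)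

theorem relDeriv_eq_of_differential_eq_comp {z : M → ℂ} (hz : IsPlanarImmersion I z) {f : M → ℂ}
    {x : M} {T : ℂ →L[ℝ] ℂ} (h : differential I f x = T.comp (differential I z x)) :
    relDeriv I z f x = T := by
  have hinv := (hz.isInvertible x)
  rw [relDeriv, h]
  ext w
  simp only [ContinuousLinearMap.comp_apply]
  rw [hinv.self_apply_inverse]

theorem smooth_mdifferentiableAt {u : M → ℂ} (hu : ContMDiff I 𝓘(ℝ, ℂ) ∞ u) (x : M) :
    MDifferentiableAt I 𝓘(ℝ, ℂ) u x :=
  (hu x).mdifferentiableAt (by simp)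

theorem differential_add {u v : M → ℂ} {x : M} (hu : MDifferentiableAt I 𝓘(ℝ, ℂ) u x)
    (hv : MDifferentiableAt I 𝓘(ℝ, ℂ) v x) :
    differential I (fun x => u x + v x) x = differential I u x + differential I v x :=
  mfderiv_add hu hv

theorem differential_mul {u v : M → ℂ} {x : M} (hu : MDifferentiableAt I 𝓘(ℝ, ℂ) u x)
    (hv : MDifferentiableAt I 𝓘(ℝ, ℂ) v x) :
    differential I (fun x => u x * v x) x = u x • differential I v x + v x • differential I u x :=
  (HasMFDerivAt.mul hu.hasMFDerivAt hv.hasMFDerivAt).mfderiv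

theorem differential_comp {g : ℂ → ℂ} {u : M → ℂ} {x : M} (hg : DifferentiableAt ℝ g (u x))
    (hu : MDifferentiableAt I 𝓘(ℝ, ℂ) u x) :
    differential I (fun x => g (u x)) x = (fderiv ℝ g (u x)).comp (differential I u x) := by
  have := mfderiv_comp x hg.mdifferentiableAt hu
  rw [mfderiv_eq_fderiv] at this
  exact this

theorem differential_congr {u v : M → ℂ} {x : M} (h : u =ᶠ[𝓝 x] v) :
    differential I u x = differential I v x := by
  have : mfderiv I 𝓘(ℝ, ℂ) u x = mfderiv I 𝓘(ℝ, ℂ) v x := h.mfderiv_eq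
  exact this

theorem differential_const (c : ℂ) (x : M) : differential I (fun _ : M => c) x = 0 :=
  mfderiv_const

theorem relDeriv_add (z : M → ℂ) {u v : M → ℂ} {x : M} (hu : MDifferentiableAt I 𝓘(ℝ, ℂ) u x)
    (hv : MDifferentiableAt I 𝓘(ℝ, ℂ) v x) :
    relDeriv I z (fun x => u x + v x) x = relDeriv I z u x + relDeriv I z v x := by
  rw [relDeriv, differential_add hu hv, ContinuousLinearMap.add_comp]; rfl

theorem relDeriv_mul (z : M → ℂ) {u v : M → ℂ} {x : M} (hu : MDifferentiableAt I 𝓘(ℝ, ℂ) u x)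
    (hv : MDifferentiableAt I 𝓘(ℝ, ℂ) v x) :
    relDeriv I z (fun x => u x * v x) x = u x • relDeriv I z v x + v x • relDeriv I z u x := by
  rw [relDeriv, differential_mul hu hv]
  rfl

theorem relDeriv_const_mul (z : M → ℂ) {u : M → ℂ} {x : M} (c : ℂ)
    (hu : MDifferentiableAt I 𝓘(ℝ, ℂ) u x) :
    relDeriv I z (fun x => c * u x) x = c • relDeriv I z u x := by
  rw [relDeriv_mul z mdifferentiableAt_const hu]
  rw [relDeriv, relDeriv, differential_const, ContinuousLinearMap.zero_comp]
  have h0 : u x • (0 : ℂ →L[ℝ] ℂ) = 0 :=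
    ContinuousLinearMap.ext fun w => mul_zero (u x)
  exact add_eq_left.2 h0

theorem relDeriv_comp {z : M → ℂ} {g : ℂ → ℂ} {u : M → ℂ} {x : M}
    (hg : DifferentiableAt ℝ g (u x)) (hu : MDifferentiableAt I 𝓘(ℝ, ℂ) u x) :
    relDeriv I z (fun x => g (u x)) x = (fderiv ℝ g (u x)).comp (relDeriv I z u x) := by
  rw [relDeriv, differential_comp hg hu]
  rfl

theorem relDeriv_congr {z u v : M → ℂ} {x : M} (h : u =ᶠ[𝓝 x] v) :
    relDeriv I z u x = relDeriv I z v x := by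
  rw [relDeriv, differential_congr h]; rfl

theorem relDeriv_self {z : M → ℂ} (hz : IsPlanarImmersion I z) (x : M) :
    relDeriv I z z x = ContinuousLinearMap.id ℝ ℂ :=
  relDeriv_eq_of_differential_eq_comp hz (by ext; rfl)

/-- A function that factors through the immersion `z` near `x` has the derivative of the
factorization as its derivative relative to `z`. -/
theorem relDeriv_of_eventuallyEq_comp {z : M → ℂ} (hz : IsPlanarImmersion I z) {u : M → ℂ}
    {g : ℂ → ℂ} {x : M} (hg : DifferentiableAt ℝ g (z x)) (h : u =ᶠ[𝓝 x] fun x => g (z x)) :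
    relDeriv I z u x = fderiv ℝ g (z x) := by
  rw [relDeriv_congr h, relDeriv_comp hg (smooth_mdifferentiableAt hz.smooth x), relDeriv_self hz]
  rfl

variable [IsManifold I ∞ M]

theorem contDiffOn_comp_extChartAt_symm {F : Type*} [NormedAddCommGroup F] [NormedSpace ℝ F]
    {u : M → F} (hu : ContMDiff I 𝓘(ℝ, F) ∞ u) (x₀ : M) :
    ContDiffOn ℝ ∞ (u ∘ (extChartAt I x₀).symm) (extChartAt I x₀).target :=
  contMDiffOn_iff_contDiffOn.1 (hu.comp_contMDiffOn (contMDiffOn_extChartAt_symm x₀))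

/-- `A` is the derivative of the inverse chart, taken within `range I` so that boundary points are
covered. It does not depend on `u`, so the differentials of two functions can be compared and `A`
cancelled. -/
theorem exists_chart_derivative (x₀ : M) {y : EuclideanSpace ℝ (Fin 2)}
    (hy : y ∈ (extChartAt I x₀).target) :
    ∃ A : EuclideanSpace ℝ (Fin 2) →L[ℝ] EuclideanSpace ℝ (Fin 2), A.IsInvertible ∧
      ∀ u : M → ℂ, MDifferentiableAt I 𝓘(ℝ, ℂ) u ((extChartAt I x₀).symm y) →
        HasFDerivWithinAt (u ∘ (extChartAt I x₀).symm)
          ((differential I u ((extChartAt I x₀).symm y)).comp A) (range I) y := by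
  have := IsManifold.of_le (I := I) (M := M) (m := 1) (n := ∞) (by simp)
  refine ⟨mfderivWithin 𝓘(ℝ, EuclideanSpace ℝ (Fin 2)) I (extChartAt I x₀).symm (range I) y,
    isInvertible_mfderivWithin_extChartAt_symm hy, fun u hu => ?_⟩
  have h1 := (mdifferentiableWithinAt_extChartAt_symm hy).hasMFDerivWithinAt
  have h2 := hu.hasMFDerivAt.comp_hasMFDerivWithinAt y h1
  exact h2.hasFDerivWithinAt

theorem hasFDerivWithinAt_comp_extChartAt_symm {z : M → ℂ} (hz : IsPlanarImmersion I z) {u : M → ℂ}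
    (x₀ : M) {y : EuclideanSpace ℝ (Fin 2)} (hy : y ∈ (extChartAt I x₀).target)
    (hu : MDifferentiableAt I 𝓘(ℝ, ℂ) u ((extChartAt I x₀).symm y)) :
    HasFDerivWithinAt (u ∘ (extChartAt I x₀).symm)
      ((relDeriv I z u ((extChartAt I x₀).symm y)).comp
        (fderivWithin ℝ (z ∘ (extChartAt I x₀).symm) (range I) y)) (range I) y := by
  obtain ⟨A, hA, h⟩ := exists_chart_derivative (I := I) x₀ hy
  have huniq : UniqueDiffWithinAt ℝ (range I) y :=
    I.uniqueDiffOn y (extChartAt_target_subset_range x₀ hy)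
  rw [(h z (smooth_mdifferentiableAt hz.smooth _)).fderivWithin huniq]
  convert! h u hu using 1
  ext v
  simp [relDeriv_apply_differential hz]

theorem isInvertible_fderivWithin_extChartAt {z : M → ℂ} (hz : IsPlanarImmersion I z)
    (x₀ : M) {y : EuclideanSpace ℝ (Fin 2)} (hy : y ∈ (extChartAt I x₀).target) :
    (fderivWithin ℝ (z ∘ (extChartAt I x₀).symm) (range I) y).IsInvertible := by
  obtain ⟨A, hA, h⟩ := exists_chart_derivative (I := I) x₀ hy
  have huniq : UniqueDiffWithinAt ℝ (range I) y :=
    I.uniqueDiffOn y (extChartAt_target_subset_range x₀ hy)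
  rw [(h z (smooth_mdifferentiableAt hz.smooth _)).fderivWithin huniq]
  exact (hz.isInvertible _).comp hA

theorem relDeriv_extChartAt_symm {z : M → ℂ} (hz : IsPlanarImmersion I z) {u : M → ℂ}
    (hu : ContMDiff I 𝓘(ℝ, ℂ) ∞ u) (x₀ : M) {y : EuclideanSpace ℝ (Fin 2)}
    (hy : y ∈ (extChartAt I x₀).target) :
    relDeriv I z u ((extChartAt I x₀).symm y) =
      (fderivWithin ℝ (u ∘ (extChartAt I x₀).symm) (range I) y).comp
        (fderivWithin ℝ (z ∘ (extChartAt I x₀).symm) (range I) y).inverse := by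
  have huniq : UniqueDiffWithinAt ℝ (range I) y :=
    I.uniqueDiffOn y (extChartAt_target_subset_range x₀ hy)
  rw [(hasFDerivWithinAt_comp_extChartAt_symm hz x₀ hy
    (smooth_mdifferentiableAt hu _)).fderivWithin huniq]
  ext w
  simp only [ContinuousLinearMap.comp_apply]
  rw [(isInvertible_fderivWithin_extChartAt hz x₀ hy).self_apply_inverse]

theorem contDiffWithinAt_fderivWithin_extChartAt {u : M → ℂ}
    (hu : ContMDiff I 𝓘(ℝ, ℂ) ∞ u) (x₀ : M) {y : EuclideanSpace ℝ (Fin 2)}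
    (hy : y ∈ (extChartAt I x₀).target) :
    ContDiffWithinAt ℝ ∞ (fderivWithin ℝ (u ∘ (extChartAt I x₀).symm) (range I)) (range I) y := by
  have h : ContDiffWithinAt ℝ ∞ (u ∘ (extChartAt I x₀).symm) (range I) y :=
    (contDiffOn_comp_extChartAt_symm hu x₀ y hy).mono_of_mem_nhdsWithin
      (extChartAt_target_mem_nhdsWithin_of_mem hy)
  exact h.fderivWithin_right I.uniqueDiffOn (by simp) (extChartAt_target_subset_range x₀ hy)

/-- In a chart this is the derivative of `u` composed with the inverse of the derivative of `z`, and
inversion is smooth at invertible maps. -/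
theorem contMDiff_relDeriv {z : M → ℂ} (hz : IsPlanarImmersion I z) {u : M → ℂ}
    (hu : ContMDiff I 𝓘(ℝ, ℂ) ∞ u) :
    ContMDiff I 𝓘(ℝ, ℂ →L[ℝ] ℂ) ∞ (relDeriv I z u) := by
  intro x₀
  have hy := mem_extChartAt_target (I := I) x₀
  have hΦ : ContDiffWithinAt ℝ ∞ (fun y =>
      (fderivWithin ℝ (u ∘ (extChartAt I x₀).symm) (range I) y).comp
        (fderivWithin ℝ (z ∘ (extChartAt I x₀).symm) (range I) y).inverse) (range I)
      (extChartAt I x₀ x₀) :=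
    (contDiffWithinAt_fderivWithin_extChartAt hu x₀ hy).clm_comp
      ((isInvertible_fderivWithin_extChartAt hz x₀ hy).contDiffAt_map_inverse.comp_contDiffWithinAt
        _ (contDiffWithinAt_fderivWithin_extChartAt hz.smooth x₀ hy))
  have hcomp := hΦ.contMDiffWithinAt.comp x₀
    (contMDiffAt_extChartAt (I := I) (n := ∞) (x := x₀)).contMDiffWithinAt (s := univ)
    (fun x _ => by simp)
  rw [contMDiffWithinAt_univ] at hcomp
  refine hcomp.congr_of_eventuallyEq ?_
  filter_upwards [extChartAt_source_mem_nhds (I := I) x₀] with x hx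
  have := relDeriv_extChartAt_symm hz hu x₀ ((extChartAt I x₀).map_source hx)
  rw [(extChartAt I x₀).left_inv hx] at this
  exact this

theorem contMDiff_dz {z : M → ℂ} (hz : IsPlanarImmersion I z) {u : M → ℂ}
    (hu : ContMDiff I 𝓘(ℝ, ℂ) ∞ u) : ContMDiff I 𝓘(ℝ, ℂ) ∞ (dz I z u) := by
  have : dz I z u = linDz ∘ relDeriv I z u := funext fun x => dz_eq_linDz z u x
  rw [this]
  exact linDz.contMDiff.comp (contMDiff_relDeriv hz hu)

theorem contMDiff_dzbar {z : M → ℂ} (hz : IsPlanarImmersion I z) {u : M → ℂ}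
    (hu : ContMDiff I 𝓘(ℝ, ℂ) ∞ u) : ContMDiff I 𝓘(ℝ, ℂ) ∞ (dzbar I z u) := by
  have : dzbar I z u = linDzbar ∘ relDeriv I z u := funext fun x => dzbar_eq_linDzbar z u x
  rw [this]
  exact linDzbar.contMDiff.comp (contMDiff_relDeriv hz hu)

end Calculus

end FreeBoundary

namespace FreeBoundary

/-! ### Gluing over simply connected spaces -/

section Topology

/-- Local functions whose differences are locally constant can be adjusted by locally constant
functions so as to fit together to a global function, if the space is simply connected. -/
theorem exists_sub_locally_constant {X A : Type*} [TopologicalSpace X] [SimplyConnectedSpace X]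
    [LocallyPathConnectedSpace X] [AddCommGroup A] (U : X → Set X) (hUo : ∀ i, IsOpen (U i))
    (hU : ∀ i, i ∈ U i) (F : X → X → A)
    (hF : ∀ i j, ∀ x ∈ U i ∩ U j, ∀ᶠ y in 𝓝 x, F i y - F j y = F i x - F j x) :
    ∃ G : X → A, ∀ i, ∀ x ∈ U i, ∀ᶠ y in 𝓝 x, G y - F i y = G x - F i x := by
  -- With the discrete topology on `A`, the differences `F i - F j` are the transition functions of
  -- a covering of `X`. Simple connectedness lifts the identity to a global section, which provides
  -- the adjusting constants.
  let _ : TopologicalSpace A := ⊥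
  have : DiscreteTopology A := ⟨rfl⟩
  let Z : FiberBundleCore X X A :=
    { baseSet := U
      isOpen_baseSet := hUo
      indexAt := id
      mem_baseSet_at := hU
      coordChange := fun i j x v => v + (F i x - F j x)
      coordChange_self := by intro i x _ v; simp
      continuousOn_coordChange := by
        intro i j
        rintro ⟨x, v⟩ ⟨hx, -⟩
        refine ContinuousAt.continuousWithinAt ?_
        have h1 : ∀ᶠ p : X × A in 𝓝 (x, v), p.2 + (F i p.1 - F j p.1) = v + (F i x - F j x) := by
          rw [nhds_prod_eq, congrFun (nhds_discrete A) v]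
          filter_upwards [prod_mem_prod (hF i j x hx) (mem_pure.2 (mem_singleton v))] with p hp
          rw [hp.1, hp.2]
        exact continuousAt_const.congr (h1.mono fun p hp => hp.symm)
      coordChange_comp := by
        intro i j k x _ v
        abel }
  have hcov : IsCoveringMap Z.proj := FiberBundle.isCoveringMap (F := A) (E := Z.Fiber)
  obtain ⟨x₀⟩ : Nonempty X := inferInstance
  obtain ⟨s, ⟨-, hs⟩, -⟩ := hcov.existsUnique_continuousMap_lifts (ContinuousMap.id X) x₀
    (⟨x₀, (0 : A)⟩ : Z.TotalSpace) rfl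
  have hs1 : ∀ x, (s x).1 = x := fun x => congrFun hs x
  let v : X → A := fun x => (s x).2
  refine ⟨fun x => v x + F x x, fun i x hx => ?_⟩
  have hval : ∀ y, ((Z.localTriv i) (s y)).2 = v y + F y y - F i y := by
    intro y
    have : ((Z.localTriv i) (s y)).2 = v y + (F (s y).1 (s y).1 - F i (s y).1) := rfl
    rw [this, hs1, add_sub_assoc]
  have hcont : ContinuousAt (fun y => ((Z.localTriv i) (s y)).2) x := by
    have h2 : s x ∈ (Z.localTriv i).source := by
      rw [Z.mem_localTriv_source, hs1]
      exact hx
    exact continuousAt_snd.comp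
      (((Z.localTriv i).continuousAt h2).comp s.continuous.continuousAt)
  have := hcont.eventually (show ∀ᶠ w in 𝓝 ((Z.localTriv i) (s x)).2,
    w = ((Z.localTriv i) (s x)).2 by rw [nhds_discrete]; exact rfl)
  filter_upwards [this] with y hy
  rwa [hval, hval] at hy

/-- Local path connectedness holds on the convex set `range I` and is carried to `M` by the charts.
Lifting to coverings requires it. -/
theorem locallyPathConnectedSpace_of_modelWithCorners {E H : Type*} [NormedAddCommGroup E]
    [NormedSpace ℝ E] [TopologicalSpace H] (I : ModelWithCorners ℝ E H) (M : Type*)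
    [TopologicalSpace M] [ChartedSpace H M] : LocallyPathConnectedSpace M := by
  have : LocallyPathConnectedSpace (range I) := I.convex_range.locallyPathConnectedSpace
  have : LocallyPathConnectedSpace H :=
    I.isClosedEmbedding.isEmbedding.toHomeomorph.isOpenEmbedding.locallyPathConnectedSpace
  exact ChartedSpace.locallyPathConnectedSpace H M

end Topology

/-! ### Primitives of holomorphic functions -/

section Primitives

variable {H : Type*} [TopologicalSpace H] {I : ModelWithCorners ℝ (EuclideanSpace ℝ (Fin 2)) H}
  {M : Type*} [TopologicalSpace M] [ChartedSpace H M] [IsManifold I ∞ M]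

/-- Every point of the chart domain has a neighbourhood that is convex in the chart. -/
theorem exists_convex_chart_nhds (I : ModelWithCorners ℝ (EuclideanSpace ℝ (Fin 2)) H) (x₀ : M)
    {N : Set (EuclideanSpace ℝ (Fin 2))} (hN : N ∈ 𝓝[range I] (extChartAt I x₀ x₀)) :
    ∃ r > 0, Metric.ball (extChartAt I x₀ x₀) r ∩ range I ⊆ N ∩ (extChartAt I x₀).target ∧
      Convex ℝ (Metric.ball (extChartAt I x₀ x₀) r ∩ range I) ∧
      IsOpen ((extChartAt I x₀).source ∩
        extChartAt I x₀ ⁻¹' Metric.ball (extChartAt I x₀ x₀) r) ∧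
      UniqueDiffOn ℝ (Metric.ball (extChartAt I x₀ x₀) r ∩ range I) ∧
      Metric.ball (extChartAt I x₀ x₀) r ∩ range I ⊆
        closure (interior (Metric.ball (extChartAt I x₀ x₀) r ∩ range I)) := by
  obtain ⟨r, hr, hsub⟩ := Metric.mem_nhdsWithin_iff.1
    (inter_mem hN (extChartAt_target_mem_nhdsWithin (I := I) x₀))
  refine ⟨r, hr, hsub, (convex_ball _ _).inter I.convex_range,
    isOpen_extChartAt_preimage' x₀ Metric.isOpen_ball, ?_, ?_⟩
  · rw [inter_comm]
    exact I.uniqueDiffOn.inter Metric.isOpen_ball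
  · rintro y ⟨hy, hy'⟩
    rw [interior_inter, Metric.isOpen_ball.interior_eq]
    exact Metric.isOpen_ball.inter_closure ⟨hy, I.range_subset_closure_interior hy'⟩

/-- The mean value inequality applies on a neighbourhood that is convex in the chart, including at
boundary points. -/
theorem eventually_eq_of_differential_eventuallyEq_zero {u : M → ℂ} {x₀ : M}
    (hu : ∀ᶠ x in 𝓝 x₀, MDifferentiableAt I 𝓘(ℝ, ℂ) u x ∧ differential I u x = 0) :
    ∀ᶠ x in 𝓝 x₀, u x = u x₀ := by
  have hN := (continuousAt_extChartAt_symm (I := I) x₀).continuousWithinAt (s := range I)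
  rw [ContinuousWithinAt, extChartAt_to_inv] at hN
  obtain ⟨r, hr, hsub, hconv, hopen, huniq, -⟩ := exists_convex_chart_nhds I x₀ (hN hu)
  filter_upwards [hopen.mem_nhds ⟨mem_extChartAt_source x₀, by simpa using hr⟩] with x hx
  have hd : ∀ y ∈ Metric.ball (extChartAt I x₀ x₀) r ∩ range I,
      HasFDerivWithinAt (u ∘ (extChartAt I x₀).symm) (0 : EuclideanSpace ℝ (Fin 2) →L[ℝ] ℂ)
        (Metric.ball (extChartAt I x₀ x₀) r ∩ range I) y := by
    intro y hy
    obtain ⟨A, -, h⟩ := exists_chart_derivative (I := I) x₀ (hsub hy).2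
    obtain ⟨h1, h2⟩ := (hsub hy).1
    have h3 := h u h1
    rw [h2, ContinuousLinearMap.zero_comp] at h3
    exact h3.mono inter_subset_right
  have h4 : u ((extChartAt I x₀).symm (extChartAt I x₀ x)) =
      u ((extChartAt I x₀).symm (extChartAt I x₀ x₀)) :=
    hconv.is_const_of_fderivWithin_eq_zero (𝕜 := ℝ) (f := u ∘ (extChartAt I x₀).symm)
      (fun y hy => (hd y hy).differentiableWithinAt)
      (fun y hy => (hd y hy).fderivWithin (huniq y hy))
      ⟨hx.2, extChartAt_target_subset_range x₀ ((extChartAt I x₀).map_source hx.1)⟩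
      ⟨by simpa using hr, extChartAt_target_subset_range x₀ (mem_extChartAt_target x₀)⟩
  rwa [(extChartAt I x₀).left_inv hx.1, extChartAt_to_inv] at h4

theorem eq_of_differential_eq_zero [PreconnectedSpace M] {u : M → ℂ}
    (hu : ContMDiff I 𝓘(ℝ, ℂ) ∞ u) (h : ∀ x, differential I u x = 0) (x y : M) : u x = u y := by
  have : IsLocallyConstant u := (IsLocallyConstant.iff_eventually_eq u).2 fun x =>
    eventually_eq_of_differential_eventuallyEq_zero
      (Eventually.of_forall fun x => ⟨smooth_mdifferentiableAt hu x, h x⟩)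
  exact this.apply_eq_of_preconnectedSpace x y

/-- A smooth function that is holomorphic relative to the immersion `z` has local primitives. -/
theorem exists_local_primitive {z : M → ℂ} (hz : IsPlanarImmersion I z) {ψ : M → ℂ}
    (hψ : ContMDiff I 𝓘(ℝ, ℂ) ∞ ψ) (hol : ∀ x, dzbar I z ψ x = 0) (x₀ : M) :
    ∃ U : Set M, IsOpen U ∧ x₀ ∈ U ∧ ∃ P : M → ℂ, ContMDiffOn I 𝓘(ℝ, ℂ) ∞ P U ∧
      ∀ x ∈ U, differential I P x = ψ x • differential I z x := by
  obtain ⟨r, hr, hsub, hconv, hopen, huniq, hclos⟩ := exists_convex_chart_nhds I x₀ univ_mem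
  set e := extChartAt I x₀ with he
  set S := Metric.ball (e x₀) r ∩ range I with hS
  have hST : S ⊆ e.target := fun y hy => (hsub hy).2
  have hzS : ContDiffOn ℝ ∞ (z ∘ e.symm) S := (contDiffOn_comp_extChartAt_symm hz.smooth x₀).mono hST
  have hψS : ContDiffOn ℝ ∞ (ψ ∘ e.symm) S := (contDiffOn_comp_extChartAt_symm hψ x₀).mono hST
  have hdzS : ContDiffOn ℝ ∞ (fderivWithin ℝ (z ∘ e.symm) S) S :=
    hzS.fderivWithin huniq (by simp)
  let η : EuclideanSpace ℝ (Fin 2) → EuclideanSpace ℝ (Fin 2) →L[ℝ] ℂ := fun y =>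
    (ψ ∘ e.symm) y • fderivWithin ℝ (z ∘ e.symm) S y
  have hη : ContDiffOn ℝ ∞ η S := hψS.smul hdzS
  have hfd : ∀ y ∈ S, fderivWithin ℝ (z ∘ e.symm) S y
      = fderivWithin ℝ (z ∘ e.symm) (range I) y := fun y hy => by
    rw [hS, inter_comm]
    exact fderivWithin_inter (Metric.isOpen_ball.mem_nhds hy.1)
  -- Poincaré lemma on the convex set `S`. The form `η = ψ dz` is closed: its derivative is the sum
  -- of `ψ d²z`, symmetric because second derivatives are, and `dψ ⊗ dz`, symmetric because `dψ =
  -- ψ_z dz` when `ψ_z̄ = 0`.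
  obtain ⟨P, hP⟩ := hconv.exists_forall_hasFDerivWithinAt_of_fderivWithin_symmetric
    (hη.differentiableOn (by simp)) (by
    intro y hy a _ b _
    have h1 : HasFDerivWithinAt (ψ ∘ e.symm) _ S y :=
      (hasFDerivWithinAt_comp_extChartAt_symm hz x₀ (hST hy)
        (smooth_mdifferentiableAt hψ _)).mono inter_subset_right
    have h2 := ((hdzS.differentiableOn (by simp)) y hy).hasFDerivWithinAt
    have h3 : fderivWithin ℝ η S y = _ := (h1.smul h2).fderivWithin (huniq y hy)
    have h4 : IsSymmSndFDerivWithinAt ℝ (z ∘ e.symm) S y :=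
      (hzS y hy).isSymmSndFDerivWithinAt
        (by rw [minSmoothness_of_isRCLikeNormedField]; exact WithTop.coe_le_coe.2 (le_top : (2 : ℕ∞) ≤ ⊤)) huniq (hclos hy) hy
    have h5 := h4.eq a b
    have h6 : ∀ w, relDeriv I z ψ (e.symm y) w = dz I z ψ (e.symm y) * w := fun w => by
      rw [apply_eq_linDz_add_linDzbar, ← dz_eq_linDz, ← dzbar_eq_linDzbar, hol]
      ring
    rw [h3]
    simp only [add_apply, smul_apply, ContinuousLinearMap.smulRight_apply, 
      ContinuousLinearMap.comp_apply]
    rw [← he, h6, h6, ← hfd y hy, h5]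
    simp only [smul_eq_mul]
    ring)
  have hPS : ContDiffOn ℝ ∞ P S := by
    rw [contDiffOn_infty_iff_fderivWithin huniq]
    exact ⟨fun y hy => (hP y hy).differentiableWithinAt,
      hη.congr fun y hy => (hP y hy).fderivWithin (huniq y hy)⟩
  have hmaps : MapsTo e (e.source ∩ e ⁻¹' Metric.ball (e x₀) r) S := fun x hx =>
    ⟨hx.2, extChartAt_target_subset_range x₀ (e.map_source hx.1)⟩
  have hPs : ContMDiffOn I 𝓘(ℝ, ℂ) ∞ (P ∘ e) (e.source ∩ e ⁻¹' Metric.ball (e x₀) r) := by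
    refine hPS.contMDiffOn.comp ?_ hmaps
    refine (contMDiffOn_extChartAt (I := I) (n := ∞) (x := x₀)).mono ?_
    rw [← extChartAt_source I]
    exact inter_subset_left
  refine ⟨_, hopen, ⟨mem_extChartAt_source x₀, by simpa using hr⟩, P ∘ e, hPs, fun x hx => ?_⟩
  have hy := hmaps hx
  have hPx : MDifferentiableAt I 𝓘(ℝ, ℂ) (P ∘ e) (e.symm (e x)) := by
    rw [e.left_inv hx.1]
    exact (hPs.contMDiffAt (hopen.mem_nhds hx)).mdifferentiableAt (by simp)
  have h1 : HasFDerivWithinAt ((P ∘ e) ∘ e.symm) (η (e x)) S (e x) :=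
    (hP _ hy).congr (fun y hy => congrArg P (e.right_inv (hST hy)))
      (congrArg P (e.right_inv (hST hy)))
  obtain ⟨A, hA, h⟩ := exists_chart_derivative (I := I) x₀ (hST hy)
  -- Uniqueness of derivatives within `S` identifies `ψ dz ∘ A` with `dP ∘ A`; the invertible `A` is
  -- cancelled below.
  have h2 := (huniq _ hy).eq h1 ((h _ hPx).mono inter_subset_right)
  have h3 := ((h z (smooth_mdifferentiableAt hz.smooth _)).mono
    (inter_subset_right : S ⊆ range I)).fderivWithin (huniq _ hy)
  have h4 : η (e x) = ψ (e.symm (e x)) • fderivWithin ℝ (z ∘ e.symm) S (e x) := rfl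
  rw [h4] at h2
  simp only [← he] at h2 h3
  rw [h3, e.left_inv hx.1] at h2
  obtain ⟨A, rfl⟩ := hA
  ext v
  have h5 := DFunLike.congr_fun h2 (A.symm v)
  simpa using h5.symm

/-- A smooth function on a simply connected surface that is holomorphic relative to the immersion
`z` has a primitive, smooth up to the boundary. -/
theorem exists_primitive [SimplyConnectedSpace M] {z : M → ℂ} (hz : IsPlanarImmersion I z)
    {ψ : M → ℂ} (hψ : ContMDiff I 𝓘(ℝ, ℂ) ∞ ψ) (hol : ∀ x, dzbar I z ψ x = 0) :
    ∃ P : M → ℂ, ContMDiff I 𝓘(ℝ, ℂ) ∞ P ∧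
      ∀ x, differential I P x = ψ x • differential I z x := by
  have := locallyPathConnectedSpace_of_modelWithCorners I M
  choose U hUo hU F hFs hFd using exists_local_primitive hz hψ hol
  have hmd : ∀ i, ∀ x ∈ U i, MDifferentiableAt I 𝓘(ℝ, ℂ) (F i) x := fun i x hx =>
    ((hFs i).contMDiffAt ((hUo i).mem_nhds hx)).mdifferentiableAt (by simp)
  -- Two local primitives have the same differential on the overlap, so their difference is locally
  -- constant there.
  obtain ⟨G, hG⟩ := exists_sub_locally_constant U hUo hU F (by
    intro i j x hx
    refine eventually_eq_of_differential_eventuallyEq_zero (I := I) (u := fun y => F i y - F j y) ?_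
    filter_upwards [((hUo i).inter (hUo j)).mem_nhds hx] with y hy
    have h1 := hmd i y hy.1
    have h2 := hmd j y hy.2
    refine ⟨h1.sub h2, ?_⟩
    have : differential I (fun y => F i y - F j y) y
        = differential I (F i) y - differential I (F j) y := mfderiv_sub h1 h2
    rw [this, hFd i y hy.1, hFd j y hy.2, sub_self])
  have hGx : ∀ x, G =ᶠ[𝓝 x] fun y => F x y + (G x - F x x) := fun x => by
    filter_upwards [hG x x (hU x)] with y hy
    rw [← hy]; ring
  refine ⟨G, fun x => ?_, fun x => ?_⟩
  · exact (((hFs x).contMDiffAt ((hUo x).mem_nhds (hU x))).add contMDiffAt_const).congr_of_eventuallyEq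
      (hGx x)
  · rw [differential_congr (hGx x), differential_add (hmd x x (hU x)) mdifferentiableAt_const,
      differential_const, hFd x x (hU x)]
    exact add_zero _

end Primitives

end FreeBoundary

namespace FreeBoundary

/-! ### Planar charts and the area measure -/

section PlanarCharts

variable {H : Type*} [TopologicalSpace H] {I : ModelWithCorners ℝ (EuclideanSpace ℝ (Fin 2)) H}
  {M : Type*} [TopologicalSpace M] [ChartedSpace H M] [IsManifold I ∞ M]

/-- On a small set that is convex in the chart the derivative of `z` stays within `1 / (2K)` of an
invertible `L` with `‖v‖ ≤ K ‖L v‖`. The mean value inequality then forces points with equal image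
to coincide. The argument is valid at boundary points and corners too. -/
theorem IsPlanarImmersion.locally_injective {z : M → ℂ} (hz : IsPlanarImmersion I z) (x₀ : M) :
    ∃ U ∈ 𝓝 x₀, InjOn z U := by
  set g := z ∘ (extChartAt I x₀).symm with hg
  obtain ⟨L, hL⟩ := isInvertible_fderivWithin_extChartAt hz x₀ (mem_extChartAt_target x₀)
  set K : ℝ := ‖(L.symm : ℂ →L[ℝ] EuclideanSpace ℝ (Fin 2))‖ + 1 with hK
  have hK0 : 0 < K := by positivity
  have hLb : ∀ v, ‖v‖ ≤ K * ‖L v‖ := fun v => by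
    have h := (L.symm : ℂ →L[ℝ] EuclideanSpace ℝ (Fin 2)).le_opNorm (L v)
    simp only [ContinuousLinearEquiv.coe_coe, ContinuousLinearEquiv.symm_apply_apply] at h
    nlinarith [norm_nonneg (L v)]
  have hcont := (contDiffWithinAt_fderivWithin_extChartAt hz.smooth x₀
    (mem_extChartAt_target x₀)).continuousWithinAt
  have hN := hcont (Metric.closedBall_mem_nhds _ (show 0 < 1 / (2 * K) by positivity))
  obtain ⟨r, hr, hsub, hconv, hopen, huniq, -⟩ := exists_convex_chart_nhds I x₀ hN
  refine ⟨_, hopen.mem_nhds ⟨mem_extChartAt_source x₀, by simpa using hr⟩, ?_⟩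
  have hd : ∀ y ∈ Metric.ball (extChartAt I x₀ x₀) r ∩ range I,
      HasFDerivWithinAt g (fderivWithin ℝ g (range I) y)
        (Metric.ball (extChartAt I x₀ x₀) r ∩ range I) y := fun y hy =>
    ((hasFDerivWithinAt_comp_extChartAt_symm hz x₀ (hsub hy).2
      (smooth_mdifferentiableAt hz.smooth _)).differentiableWithinAt.hasFDerivWithinAt).mono
        inter_subset_right
  have hbound : ∀ y ∈ Metric.ball (extChartAt I x₀ x₀) r ∩ range I,
      ‖fderivWithin ℝ g (range I) y - (L : EuclideanSpace ℝ (Fin 2) →L[ℝ] ℂ)‖ ≤ 1 / (2 * K) := by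
    intro y hy
    have := (hsub hy).1
    rwa [mem_preimage, Metric.mem_closedBall, ← hL, dist_eq_norm] at this
  intro x hx x' hx' hxx
  have hmem : ∀ x ∈ (extChartAt I x₀).source ∩
      extChartAt I x₀ ⁻¹' Metric.ball (extChartAt I x₀ x₀) r,
      extChartAt I x₀ x ∈ Metric.ball (extChartAt I x₀ x₀) r ∩ range I := fun x hx =>
    ⟨hx.2, extChartAt_target_subset_range x₀ ((extChartAt I x₀).map_source hx.1)⟩
  have hgx : ∀ x ∈ (extChartAt I x₀).source ∩
      extChartAt I x₀ ⁻¹' Metric.ball (extChartAt I x₀ x₀) r,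
      g (extChartAt I x₀ x) = z x := fun x hx =>
    congrArg z ((extChartAt I x₀).left_inv hx.1)
  have h1 := hconv.norm_image_sub_le_of_norm_hasFDerivWithin_le' hd hbound (hmem x hx) (hmem x' hx')
  rw [hgx x hx, hgx x' hx', hxx, sub_self, zero_sub, norm_neg] at h1
  have h2 := hLb (extChartAt I x₀ x' - extChartAt I x₀ x)
  have h3 : K * (1 / (2 * K) * ‖extChartAt I x₀ x' - extChartAt I x₀ x‖)
      = ‖extChartAt I x₀ x' - extChartAt I x₀ x‖ / 2 := by field_simp
  have h4 := mul_le_mul_of_nonneg_left h1 hK0.le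
  rw [h3] at h4
  have h5 : ‖extChartAt I x₀ x' - extChartAt I x₀ x‖ = 0 :=
    le_antisymm (by simp only [ContinuousLinearEquiv.coe_coe] at h4; linarith) (norm_nonneg _)
  exact ((extChartAt I x₀).injOn hx'.1 hx.1 (sub_eq_zero.1 (norm_eq_zero.1 h5))).symm

variable (I) in
/-- A section `σ` over the open set `W` of the plane of the immersion `z`, with open image, such
that smooth functions on `M` are smooth functions of `z` on this image. -/
structure IsPlanarChart (z : M → ℂ) (W : Set ℂ) (σ : ℂ → M) : Prop where
  isOpen : IsOpen W
  isOpen_image : IsOpen (σ '' W)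
  section_apply : ∀ w ∈ W, z (σ w) = w
  continuousOn : ContinuousOn σ W
  contDiffOn : ∀ u : M → ℂ, ContMDiff I 𝓘(ℝ, ℂ) ∞ u → ContDiffOn ℝ ∞ (u ∘ σ) W

/-- Planar charts are dense in `M`. -/
theorem exists_isPlanarChart {z : M → ℂ} (hz : IsPlanarImmersion I z) {O : Set M} (hO : IsOpen O)
    (hne : O.Nonempty) :
    ∃ W : Set ℂ, ∃ σ : ℂ → M, IsPlanarChart I z W σ ∧ W.Nonempty ∧ MapsTo σ W O := by
  obtain ⟨x₀, hx₀⟩ := hne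
  set e := extChartAt I x₀ with he
  have hpre : e.symm ⁻¹' O ∩ e.target ∈ 𝓝[range I] (e x₀) := by
    refine inter_mem ?_ (extChartAt_target_mem_nhdsWithin x₀)
    have hN := (continuousAt_extChartAt_symm (I := I) x₀).continuousWithinAt (s := range I)
    rw [ContinuousWithinAt, extChartAt_to_inv] at hN
    exact hN (hO.mem_nhds hx₀)
  obtain ⟨B, hBo, hxB, hB⟩ := mem_nhdsWithin.1 hpre
  -- The given point may lie on the boundary. The inverse function theorem is applied at a nearby
  -- point `y₀` in the interior of `range I`.
  obtain ⟨y₀, hy₀⟩ := mem_closure_iff.1 (I.range_subset_closure_interior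
    (extChartAt_target_subset_range x₀ (mem_extChartAt_target x₀))) B hBo hxB
  set U : Set (EuclideanSpace ℝ (Fin 2)) := B ∩ interior (range I) with hU
  have hUo : IsOpen U := hBo.inter isOpen_interior
  have hUsub : U ⊆ e.symm ⁻¹' O ∩ e.target := fun y hy => hB ⟨hy.1, interior_subset hy.2⟩
  have hUr : ∀ y ∈ U, range I ∈ 𝓝 y := fun y hy => mem_interior_iff_mem_nhds.1 hy.2
  have hsm : ∀ u : M → ℂ, ContMDiff I 𝓘(ℝ, ℂ) ∞ u → ∀ y ∈ U, ContDiffAt ℝ ∞ (u ∘ e.symm) y :=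
    fun u hu y hy => (((contDiffOn_comp_extChartAt_symm hu x₀).mono
      (fun y hy => (hUsub hy).2)).contDiffAt (hUo.mem_nhds hy))
  have hder : ∀ y ∈ U, ∃ L : EuclideanSpace ℝ (Fin 2) ≃L[ℝ] ℂ,
      HasFDerivAt (z ∘ e.symm) (L : EuclideanSpace ℝ (Fin 2) →L[ℝ] ℂ) y := by
    intro y hy
    obtain ⟨L, hL⟩ := isInvertible_fderivWithin_extChartAt hz x₀ (hUsub hy).2
    refine ⟨L, ?_⟩
    rw [hL, fderivWithin_of_mem_nhds (hUr y hy)]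
    exact ((hsm z hz.smooth y hy).differentiableAt (by simp)).hasFDerivAt
  obtain ⟨L₀, hL₀⟩ := hder y₀ hy₀
  let Φ := ((hsm z hz.smooth y₀ hy₀).toOpenPartialHomeomorph _ hL₀ (by simp)).restrOpen U hUo
  have hΦ : ∀ y, Φ y = z (e.symm y) := fun y => rfl
  have hΦs : Φ.source ⊆ U := inter_subset_right
  have hΦy : y₀ ∈ Φ.source :=
    ⟨(hsm z hz.smooth y₀ hy₀).mem_toOpenPartialHomeomorph_source hL₀ (by simp), hy₀⟩
  have himg : (fun w => e.symm (Φ.symm w)) '' Φ.target = e.source ∩ e ⁻¹' Φ.source := by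
    ext x
    constructor
    · rintro ⟨w, hw, rfl⟩
      have h1 := Φ.map_target hw
      have h2 := (hUsub (hΦs h1)).2
      refine ⟨e.map_target h2, ?_⟩
      rw [mem_preimage, e.right_inv h2]
      exact h1
    · rintro ⟨hx, hx'⟩
      exact ⟨Φ (e x), Φ.map_source hx', by
        simp only []
        rw [Φ.left_inv hx', e.left_inv hx]⟩
  refine ⟨Φ.target, fun w => e.symm (Φ.symm w), ⟨Φ.open_target, ?_, fun w hw => ?_, ?_, ?_⟩,
    ⟨Φ y₀, Φ.map_source hΦy⟩, fun w hw => (hUsub (hΦs (Φ.map_target hw))).1⟩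
  · rw [himg]
    exact isOpen_extChartAt_preimage' x₀ Φ.open_source
  · rw [← hΦ, Φ.right_inv hw]
  · exact (continuousOn_extChartAt_symm x₀).comp Φ.continuousOn_symm
      (fun w hw => (hUsub (hΦs (Φ.map_target hw))).2)
  · intro u hu w hw
    have hy := hΦs (Φ.map_target hw)
    obtain ⟨L, hL⟩ := hder _ hy
    have h1 : ContDiffAt ℝ ∞ Φ.symm w := Φ.contDiffAt_symm hw hL (hsm z hz.smooth _ hy)
    exact ((hsm u hu _ hy).comp w h1).contDiffWithinAt

namespace IsPlanarChart

variable {z : M → ℂ} {W : Set ℂ} {σ : ℂ → M}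

omit [IsManifold I ∞ M] in
theorem section_apply_of_mem (h : IsPlanarChart I z W σ) {x : M} (hx : x ∈ σ '' W) :
    σ (z x) = x ∧ z x ∈ W := by
  obtain ⟨w, hw, rfl⟩ := hx
  rw [h.section_apply w hw]
  exact ⟨rfl, hw⟩

omit [IsManifold I ∞ M] in
theorem injOn (h : IsPlanarChart I z W σ) : InjOn z (σ '' W) := fun x hx y hy hxy => by
  rw [← (h.section_apply_of_mem hx).1, hxy, (h.section_apply_of_mem hy).1]

omit [IsManifold I ∞ M] in
theorem relDeriv_eq (h : IsPlanarChart I z W σ) (hz : IsPlanarImmersion I z) {u : M → ℂ}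
    (hu : ContMDiff I 𝓘(ℝ, ℂ) ∞ u) {w : ℂ} (hw : w ∈ W) :
    relDeriv I z u (σ w) = fderiv ℝ (u ∘ σ) w := by
  have h1 := relDeriv_of_eventuallyEq_comp hz (u := u) (g := u ∘ σ) (x := σ w) (by
    rw [h.section_apply w hw]
    exact ((h.contDiffOn u hu).contDiffAt (h.isOpen.mem_nhds hw)).differentiableAt (by simp)) (by
    filter_upwards [h.isOpen_image.mem_nhds (mem_image_of_mem σ hw)] with x hx
    exact congrArg u (h.section_apply_of_mem hx).1.symm)
  rwa [h.section_apply w hw] at h1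

omit [IsManifold I ∞ M] in
/-- Integrals over a planar chart are integrals over a domain of the plane. -/
theorem setIntegral_eq [PolishSpace M] [MeasurableSpace M] [BorelSpace M]
    (h : IsPlanarChart I z W σ) (hz : Continuous z) (hinj : ∀ x, ∃ U ∈ 𝓝 x, InjOn z U)
    {F : M → ℂ} (hF : Continuous F) :
    ∫ x in σ '' W, F x ∂(pullbackArea z) = ∫ w in W, F (σ w) := by
  -- `z` is injective on `σ '' W`, so it carries the area measure there to Lebesgue measure on `W`.
  have hmap : ((pullbackArea z).restrict (σ '' W)).map z = (volume : Measure ℂ).restrict W := by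
    ext B hB
    rw [Measure.map_apply hz.measurable hB, Measure.restrict_apply (hz.measurable hB),
      Measure.restrict_apply hB, pullbackArea_of_injOn hz hinj
        ((hz.measurable hB).inter h.isOpen_image.measurableSet) (h.injOn.mono inter_subset_right)]
    congr 1
    ext w
    constructor
    · rintro ⟨x, ⟨hx, hx'⟩, rfl⟩
      exact ⟨hx, (h.section_apply_of_mem hx').2⟩
    · rintro ⟨hw, hw'⟩
      exact ⟨σ w, ⟨by rwa [mem_preimage, h.section_apply w hw'], mem_image_of_mem σ hw'⟩,
        h.section_apply w hw'⟩
  rw [← hmap, integral_map hz.aemeasurable]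
  · refine setIntegral_congr_fun h.isOpen_image.measurableSet fun x hx => ?_
    simp only [(h.section_apply_of_mem hx).1]
  · rw [hmap]
    exact (hF.comp_continuousOn h.continuousOn).aestronglyMeasurable h.isOpen.measurableSet

end IsPlanarChart

theorem polishSpace_of_compact (I : ModelWithCorners ℝ (EuclideanSpace ℝ (Fin 2)) H)
    [T2Space M] [CompactSpace M] : PolishSpace M := by
  have : SecondCountableTopology H := I.secondCountableTopology
  have : SecondCountableTopology M := ChartedSpace.secondCountable_of_sigmaCompact H M
  have : TopologicalSpace.MetrizableSpace M := TopologicalSpace.metrizableSpace_of_t3_secondCountable M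
  let _ := TopologicalSpace.metrizableSpaceMetric M
  infer_instance

/-- Each point has a neighbourhood on which `z` is injective with image in a disc of radius one,
hence of finite area. Compactness does the rest. -/
theorem isFiniteMeasure_pullbackArea [PolishSpace M] [CompactSpace M] [MeasurableSpace M]
    [BorelSpace M] {z : M → ℂ} (hz : IsPlanarImmersion I z) :
    IsFiniteMeasure (pullbackArea z) := by
  have hfin : ∀ x ∈ (univ : Set M), (pullbackArea z).FiniteAtFilter (𝓝[univ] x) := by
    intro x _
    obtain ⟨U, hU, hUi⟩ := hz.locally_injective x
    have hb : z ⁻¹' Metric.ball (z x) 1 ∈ 𝓝 x :=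
      hz.smooth.continuous.continuousAt (Metric.ball_mem_nhds _ one_pos)
    refine ⟨interior U ∩ z ⁻¹' Metric.ball (z x) 1, by
      rw [nhdsWithin_univ]; exact inter_mem (interior_mem_nhds.2 hU) hb, ?_⟩
    rw [pullbackArea_of_injOn hz.smooth.continuous hz.locally_injective
      (isOpen_interior.measurableSet.inter
        (hz.smooth.continuous.measurable measurableSet_ball))
      (hUi.mono (inter_subset_left.trans interior_subset))]
    refine (measure_mono (image_subset_iff.2 inter_subset_right)).trans_lt measure_ball_lt_top
  exact ⟨isCompact_univ.measure_lt_top_of_nhdsWithin hfin⟩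

/-- Every nonempty open set contains a planar chart, whose area is that of a nonempty open subset of
the plane. -/
theorem isOpenPosMeasure_pullbackArea [PolishSpace M] [MeasurableSpace M]
    [BorelSpace M] {z : M → ℂ} (hz : IsPlanarImmersion I z) :
    (pullbackArea z).IsOpenPosMeasure := by
  refine ⟨fun O hO hne h0 => ?_⟩
  obtain ⟨W, σ, h, hWne, hWO⟩ := exists_isPlanarChart hz hO hne
  have h1 : pullbackArea z (σ '' W) = 0 := measure_mono_null hWO.image_subset h0
  rw [pullbackArea_of_injOn hz.smooth.continuous hz.locally_injective h.isOpen_image.measurableSet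
    h.injOn] at h1
  have h2 : z '' (σ '' W) = W := by
    rw [← image_comp]
    exact (image_congr h.section_apply).trans (image_id' W)
  rw [h2] at h1
  exact (h.isOpen.measure_pos volume hWne).ne' h1

end PlanarCharts

end FreeBoundary

namespace FreeBoundary

/-! ### The first variation of the energy -/

section FirstVariation

theorem IsElasticPotential.contDiffOn_deriv {V : ℝ → ℝ} (hV : IsElasticPotential V) :
    ContDiffOn ℝ ∞ (deriv V) (Ioi 0) :=
  hV.smooth.deriv_of_isOpen isOpen_Ioi (by simp)

theorem IsElasticPotential.hasDerivAt {V : ℝ → ℝ} (hV : IsElasticPotential V) {x : ℝ}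
    (hx : 0 < x) : HasDerivAt V (deriv V x) x :=
  ((hV.smooth.contDiffAt (Ioi_mem_nhds hx)).differentiableAt (by simp)).hasDerivAt

theorem IsElasticPotential.deriv_one {V : ℝ → ℝ} (hV : IsElasticPotential V) : deriv V 1 = 0 := by
  refine IsLocalMin.deriv_eq_zero ?_
  filter_upwards [Ioi_mem_nhds (show (0 : ℝ) < 1 from one_pos)] with x hx
  rw [hV.map_one]
  rcases eq_or_ne x 1 with rfl | h
  · rw [hV.map_one]
  · exact (hV.pos_of_ne_one x hx h).le

theorem IsElasticPotential.strictMonoOn_deriv {V : ℝ → ℝ} (hV : IsElasticPotential V) :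
    StrictMonoOn (deriv V) (Ioi 0) :=
  hV.strictConvex.strictMonoOn_deriv fun _ hx => (hV.hasDerivAt hx).differentiableAt

/-- Differentiation under the integral sign for the elastic energy of an affine family. -/
theorem hasDerivAt_integral_energy {X : Type*} [TopologicalSpace X] [CompactSpace X]
    [SecondCountableTopology X] [MeasurableSpace X] [BorelSpace X] {μ : Measure X}
    [IsFiniteMeasure μ] {V : ℝ → ℝ} (hV : IsElasticPotential V) {a b c d : X → ℂ}
    (ha : Continuous a) (hb : Continuous b) (hc : Continuous c) (hd : Continuous d)
    (ha0 : ∀ x, a x ≠ 0) :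
    HasDerivAt (fun t : ℝ => ∫ x, (V (‖a x + t * b x‖ ^ 2) + ‖c x + t * d x‖ ^ 2) ∂μ)
      (∫ x, (deriv V (‖a x‖ ^ 2) * (2 * inner ℝ (a x) (b x)) + 2 * inner ℝ (c x) (d x)) ∂μ) 0 := by
  rcases isEmpty_or_nonempty X with hX | hX
  · have : μ = 0 := Measure.eq_zero_of_isEmpty μ
    simp only [this, integral_zero_measure]
    exact hasDerivAt_const _ _
  -- `V` is controlled only on `(0, ∞)`. Compactness gives one `ε` for which its argument stays
  -- positive for all `|t| ≤ ε` and all `x`.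
  obtain ⟨ε, hε, hne⟩ : ∃ ε > (0 : ℝ), ∀ t ∈ Icc (-ε) ε, ∀ x, a x + t * b x ≠ 0 := by
    have hev : ∀ᶠ t : ℝ in 𝓝 0, ∀ x ∈ (univ : Set X), a x + t * b x ≠ 0 := by
      refine isCompact_univ.eventually_forall_of_forall_eventually fun x _ => ?_
      have hcts : Continuous fun p : ℝ × X => a p.2 + p.1 * b p.2 := by fun_prop
      exact hcts.continuousAt.eventually_ne (by simpa using ha0 x)
    obtain ⟨ε, hε, hsub⟩ := Metric.nhds_basis_closedBall.mem_iff.1 hev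
    rw [Real.closedBall_eq_Icc, zero_sub, zero_add] at hsub
    exact ⟨ε, hε, fun t ht x => hsub ht x (mem_univ x)⟩
  let F' : ℝ → X → ℝ := fun t x =>
    deriv V (‖a x + t * b x‖ ^ 2) * (2 * inner ℝ (a x + t * b x) (b x))
      + 2 * inner ℝ (c x + t * d x) (d x)
  have hpos : ∀ t ∈ Icc (-ε) ε, ∀ x, 0 < ‖a x + t * b x‖ ^ 2 := fun t ht x => by
    have := norm_pos_iff.2 (hne t ht x)
    positivity
  have hline : ∀ (p q : ℂ) (t : ℝ), HasDerivAt (fun t : ℝ => p + (t : ℂ) * q) q t := fun p q t => by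
    simpa using ((Complex.ofRealCLM.hasDerivAt (x := t)).mul_const q).const_add p
  have hF'c : ContinuousOn (fun p : ℝ × X => F' p.1 p.2) (Icc (-ε) ε ×ˢ univ) := by
    refine ContinuousOn.add (ContinuousOn.mul ?_ ?_) ?_
    · refine hV.contDiffOn_deriv.continuousOn.comp (t := Ioi 0) ?_ fun p hp => hpos p.1 hp.1 p.2
      fun_prop
    · exact Continuous.continuousOn (by fun_prop)
    · exact Continuous.continuousOn (by fun_prop)
  -- The constant `C` dominates the derivative in `t`, and constants are integrable because the
  -- measure is finite.
  obtain ⟨C, hC⟩ := (isCompact_Icc.prod isCompact_univ).exists_bound_of_continuousOn hF'c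
  have hFc : ∀ t ∈ Icc (-ε) ε, Continuous fun x => V (‖a x + t * b x‖ ^ 2) + ‖c x + t * d x‖ ^ 2 := by
    intro t ht
    refine Continuous.add ?_ (by fun_prop)
    exact hV.smooth.continuousOn.comp_continuous (by fun_prop) (hpos t ht)
  have h0 : (0 : ℝ) ∈ Icc (-ε) ε := ⟨by linarith, hε.le⟩
  have hmeas : ∀ᶠ t : ℝ in 𝓝 0, AEStronglyMeasurable
      (fun x => V (‖a x + t * b x‖ ^ 2) + ‖c x + t * d x‖ ^ 2) μ := by
    filter_upwards [Icc_mem_nhds (show -ε < 0 by linarith) hε] with t ht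
    exact (hFc t ht).aestronglyMeasurable
  have hint : Integrable
      (fun x => V (‖a x + (0 : ℝ) * b x‖ ^ 2) + ‖c x + (0 : ℝ) * d x‖ ^ 2) μ := by
    obtain ⟨C', hC'⟩ := isCompact_univ.exists_bound_of_continuousOn (hFc 0 h0).continuousOn
    exact Integrable.of_bound (hFc 0 h0).aestronglyMeasurable C'
      (Eventually.of_forall fun x => hC' x (mem_univ x))
  have hmeas' : AEStronglyMeasurable (F' 0) μ := by
    have h1 : Continuous fun x : X => ((0 : ℝ), x) := by fun_prop
    have h2 := hF'c.comp_continuous h1 fun x => ⟨h0, mem_univ x⟩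
    exact h2.aestronglyMeasurable
  have hdiff : ∀ x, ∀ t ∈ Icc (-ε) ε, HasDerivAt
      (fun t : ℝ => V (‖a x + t * b x‖ ^ 2) + ‖c x + t * d x‖ ^ 2) (F' t x) t := by
    intro x t ht
    have e1 : HasDerivAt (fun t : ℝ => V (‖a x + t * b x‖ ^ 2)) _ t :=
      (hV.hasDerivAt (hpos t ht x)).comp t (hline (a x) (b x) t).norm_sq
    exact e1.add (hline (c x) (d x) t).norm_sq
  have key := (hasDerivAt_integral_of_dominated_loc_of_deriv_le (𝕜 := ℝ) (E := ℝ) (μ := μ)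
    (bound := fun _ => C) (Icc_mem_nhds (show -ε < 0 by linarith) hε) hmeas hint hmeas'
    (Eventually.of_forall fun x t ht => hC (t, x) ⟨ht, mem_univ x⟩) (integrable_const C)
    (Eventually.of_forall hdiff)).2
  simpa [F'] using key

theorem smooth_mul {E H M : Type*} [NormedAddCommGroup E] [NormedSpace ℝ E] [TopologicalSpace H]
    {I : ModelWithCorners ℝ E H} [TopologicalSpace M] [ChartedSpace H M] {u v : M → ℂ}
    (hu : ContMDiff I 𝓘(ℝ, ℂ) ∞ u) (hv : ContMDiff I 𝓘(ℝ, ℂ) ∞ v) :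
    ContMDiff I 𝓘(ℝ, ℂ) ∞ fun x => u x * v x := by
  have h : ContDiff ℝ ∞ fun p : ℂ × ℂ => p.1 * p.2 := contDiff_fst.mul contDiff_snd
  exact h.contMDiff.comp (hu.prodMk_space hv)

variable {H : Type*} [TopologicalSpace H] {I : ModelWithCorners ℝ (EuclideanSpace ℝ (Fin 2)) H}
  {M : Type*} [TopologicalSpace M] [ChartedSpace H M]

theorem dz_ne_zero {z f : M → ℂ} (hf : IsOrientationPreservingImmersion I z f) (x : M) :
    dz I z f x ≠ 0 := by
  intro h
  have h1 := hf.det_pos x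
  rw [det_eq_normSq_sub_normSq, ← dz_eq_linDz, h] at h1
  simp only [norm_zero] at h1
  nlinarith [sq_nonneg ‖linDzbar (relDeriv I z f x)‖]

variable [IsManifold I ∞ M]

/-- The first variation of the elastic energy, in complex form. -/
theorem integral_first_variation_eq_zero [CompactSpace M] [PolishSpace M] [MeasurableSpace M]
    [BorelSpace M] {V : ℝ → ℝ} (hV : IsElasticPotential V) {z : M → ℂ}
    (hz : IsPlanarImmersion I z) {f : M → ℂ} (hf : IsOrientationPreservingImmersion I z f)
    (hcrit : IsCriticalForAllVariations I V z f) {h : M → ℂ} (hh : ContMDiff I 𝓘(ℝ, ℂ) ∞ h) :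
    ∫ x, (conj (((deriv V (‖dz I z f x‖ ^ 2) : ℝ) : ℂ) * dz I z f x) * dz I z h x
      + conj (dzbar I z f x) * dzbar I z h x) ∂(pullbackArea z) = 0 := by
  have := isFiniteMeasure_pullbackArea hz
  set Q : (M → ℂ) → M → ℂ := fun h x =>
    conj (((deriv V (‖dz I z f x‖ ^ 2) : ℝ) : ℂ) * dz I z f x) * dz I z h x
      + conj (dzbar I z f x) * dzbar I z h x with hQ
  have hfs := hf.immersion.smooth
  have hdzc := (contMDiff_dz hz hfs).continuous
  have hdzbc := (contMDiff_dzbar hz hfs).continuous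
  have hVc : Continuous fun x => deriv V (‖dz I z f x‖ ^ 2) :=
    hV.contDiffOn_deriv.continuousOn.comp_continuous (by fun_prop) fun x => by
      have := norm_pos_iff.2 (dz_ne_zero hf x)
      exact pow_pos this 2
  have hQc : ∀ h, ContMDiff I 𝓘(ℝ, ℂ) ∞ h → Continuous (Q h) := by
    intro h hh
    have h1 := (contMDiff_dz hz hh).continuous
    have h2 := (contMDiff_dzbar hz hh).continuous
    fun_prop
  have hQi : ∀ h, ContMDiff I 𝓘(ℝ, ℂ) ∞ h → Integrable (Q h) (pullbackArea z) := by
    intro h hh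
    obtain ⟨C, hC⟩ := isCompact_univ.exists_bound_of_continuousOn (hQc h hh).continuousOn
    exact Integrable.of_bound (hQc h hh).aestronglyMeasurable C
      (Eventually.of_forall fun x => hC x (mem_univ x))
  -- The derivative of the energy is only the real part of the complex integral. Since `Q` is
  -- complex-linear in `h`, the variation `i h` yields the imaginary part.
  have hre : ∀ h, ContMDiff I 𝓘(ℝ, ℂ) ∞ h → (∫ x, Q h x ∂(pullbackArea z)).re = 0 := by
    intro h hh
    have hlin : ∀ (t : ℝ) (x : M), relDeriv I z (fun x => f x + (t : ℂ) * h x) x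
        = relDeriv I z f x + (t : ℂ) • relDeriv I z h x := fun t x => by
      have h1 := smooth_mdifferentiableAt hh x
      have h2 := smooth_mdifferentiableAt (smooth_mul (contMDiff_const (c := (t : ℂ))) hh) x
      rw [relDeriv_add z (smooth_mdifferentiableAt hfs x) h2, relDeriv_const_mul z _ h1]
    have h1 := hcrit h hh
    have h2 := (hasDerivAt_integral_energy (μ := pullbackArea z) hV hdzc
      (contMDiff_dz hz hh).continuous hdzbc (contMDiff_dzbar hz hh).continuous
      (dz_ne_zero hf)).const_mul (1 / 2 : ℝ)
    have h3 : (fun t : ℝ => elasticEnergy I V z (fun x => f x + (t : ℂ) * h x)) = fun t : ℝ =>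
        (1 / 2 : ℝ) * ∫ x, (V (‖dz I z f x + t * dz I z h x‖ ^ 2)
          + ‖dzbar I z f x + t * dzbar I z h x‖ ^ 2) ∂(pullbackArea z) := by
      funext t
      simp only [elasticEnergy, dz_eq_linDz, dzbar_eq_linDzbar, hlin, map_add, linDz_mul_smul,
        linDzbar_mul_smul]
    rw [h3] at h1
    have h4 := h2.unique h1
    rw [← integral_const_mul] at h4
    rw [← RCLike.re_eq_complex_re, ← integral_re (hQi h hh), ← h4]
    refine integral_congr_ae (Eventually.of_forall fun x => ?_)
    have hin : ∀ p q : ℂ, inner ℝ p q = (conj p * q).re := fun p q => by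
      rw [Complex.inner, mul_comm]
    simp only [hQ, hin, map_mul, Complex.conj_ofReal, RCLike.re_eq_complex_re,
      Complex.add_re, mul_assoc, Complex.re_ofReal_mul]
    ring
  refine Complex.ext (hre h hh) ?_
  have hIh : ContMDiff I 𝓘(ℝ, ℂ) ∞ fun x => Complex.I * h x := smooth_mul contMDiff_const hh
  have h1 := hre _ hIh
  have h2 : Q (fun x => Complex.I * h x) = fun x => Complex.I * Q h x := by
    funext x
    simp only [hQ, dz_eq_linDz, dzbar_eq_linDzbar, linDz_mul_smul, linDzbar_mul_smul,
      relDeriv_const_mul z _ (smooth_mdifferentiableAt hh x)]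
    ring
  rw [h2, integral_const_mul] at h1
  have h3 : (∫ x, Q h x ∂(pullbackArea z)).im = 0 := by simpa using h1
  exact h3

end FirstVariation

end FreeBoundary

namespace FreeBoundary

/-! ### The Euler-Lagrange equation -/

section EulerLagrange

/-- Integration by parts against the constant function `1`. -/
theorem integral_fderiv_eq_zero {E F : Type*} [NormedAddCommGroup E] [NormedSpace ℝ E]
    [FiniteDimensional ℝ E] [MeasurableSpace E] [BorelSpace E] {μ : Measure E} [μ.IsAddHaarMeasure]
    [NormedAddCommGroup F] [NormedSpace ℝ F] [CompleteSpace F] {P : E → F} (hP : ContDiff ℝ 1 P)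
    (hc : HasCompactSupport P) : ∫ w, fderiv ℝ P w ∂μ = 0 := by
  have hint : Integrable (fderiv ℝ P) μ :=
    (hP.continuous_fderiv (by simp)).integrable_of_hasCompactSupport (hc.fderiv ℝ)
  ext v
  rw [ContinuousLinearMap.integral_apply hint]
  have h := integral_smul_fderiv_eq_neg_fderiv_smul_of_integrable (μ := μ) (𝕜 := ℝ)
    (f := fun _ : E => (1 : ℝ)) (g := P) (v := v) (by simp)
    (by simpa using hint.apply_continuousLinearMap v)
    (by simpa using hP.continuous.integrable_of_hasCompactSupport hc)
    (fun _ _ => differentiableAt_const _) (fun x _ => hP.differentiable (by simp) x)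
  simpa using h

theorem conj_linDz_of_real {A : ℂ →L[ℝ] ℂ} (hA : ∀ w, (A w).im = 0) :
    conj (linDz A) = linDzbar A := by
  have h : ∀ w, conj (A w) = A w := fun w => Complex.conj_eq_iff_im.2 (hA w)
  rw [linDz_apply, linDzbar_apply, map_div₀, map_sub, map_mul, h, h, Complex.conj_I,
    Complex.conj_eq_iff_im.2 (show (2 : ℂ).im = 0 by simp)]
  ring

theorem linDzbar_linDz_comm {B : ℂ →L[ℝ] ℂ →L[ℝ] ℂ} (hB : B 1 Complex.I = B Complex.I 1) :
    linDzbar (linDz.comp B) = linDz (linDzbar.comp B) := by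
  simp only [linDz_apply, linDzbar_apply, ContinuousLinearMap.comp_apply]
  rw [hB]
  ring

/-- A pair of functions on a plane domain that is orthogonal to `(k_z̄, k_z)` for all real test
functions `k` satisfies `a_z̄ + c_z = 0`. -/
theorem linDzbar_add_linDz_eq_zero_of_integral {W : Set ℂ} (hW : IsOpen W) {a c : ℂ → ℂ}
    (ha : ContDiffOn ℝ ∞ a W) (hc : ContDiffOn ℝ ∞ c W)
    (h : ∀ k : ℂ → ℝ, ContDiff ℝ ∞ k → HasCompactSupport k → tsupport k ⊆ W →
      ∫ w in W, (a w * linDzbar (fderiv ℝ (fun w => (k w : ℂ)) w)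
        + c w * linDz (fderiv ℝ (fun w => (k w : ℂ)) w)) = 0) :
    ∀ w ∈ W, linDzbar (fderiv ℝ a w) + linDz (fderiv ℝ c w) = 0 := by
  set R : ℂ → ℂ := fun w => linDzbar (fderiv ℝ a w) + linDz (fderiv ℝ c w) with hR
  have hRc : ContinuousOn R W := by
    have h1 := ha.continuousOn_fderiv_of_isOpen hW (by simp)
    have h2 := hc.continuousOn_fderiv_of_isOpen hW (by simp)
    exact (linDzbar.continuous.comp_continuousOn h1).add (linDz.continuous.comp_continuousOn h2)
  have hae : ∀ᵐ w ∂(volume : Measure ℂ), w ∈ W → R w = 0 := by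
    refine hW.ae_eq_zero_of_integral_contDiff_smul_eq_zero
      (hRc.locallyIntegrableOn hW.measurableSet) fun k hk hkc hks => ?_
    have hkC : ContDiff ℝ ∞ fun w => (k w : ℂ) := Complex.ofRealCLM.contDiff.comp hk
    have hzero : ∀ w, w ∉ tsupport k → (fun w => (k w : ℂ)) =ᶠ[𝓝 w] fun _ => 0 := fun w hw => by
      filter_upwards [(isClosed_tsupport k).isOpen_compl.mem_nhds hw] with w' hw'
      rw [image_eq_zero_of_notMem_tsupport hw', Complex.ofReal_zero]
    have hprod : ∀ b : ℂ → ℂ, ContDiffOn ℝ ∞ b W →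
        ContDiff ℝ ∞ (fun w => b w * (k w : ℂ)) ∧ HasCompactSupport (fun w => b w * (k w : ℂ)) ∧
        (∀ w ∈ W, fderiv ℝ (fun w => b w * (k w : ℂ)) w
          = b w • fderiv ℝ (fun w => (k w : ℂ)) w + (k w : ℂ) • fderiv ℝ b w) ∧
        ∀ w, w ∉ W → fderiv ℝ (fun w => b w * (k w : ℂ)) w = 0 := by
      intro b hb
      have hz : ∀ w, w ∉ tsupport k → (fun w => b w * (k w : ℂ)) =ᶠ[𝓝 w] fun _ => 0 := fun w hw => by
        filter_upwards [hzero w hw] with w' hw'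
        rw [hw', mul_zero]
      refine ⟨contDiff_iff_contDiffAt.2 fun w => ?_, ?_, fun w hw => ?_, fun w hw => ?_⟩
      · by_cases hw : w ∈ tsupport k
        · exact (hb.contDiffAt (hW.mem_nhds (hks hw))).mul hkC.contDiffAt
        · exact contDiffAt_const.congr_of_eventuallyEq (hz w hw)
      · refine hkc.mono' fun w hw => subset_tsupport k fun h0 => hw ?_
        simp only [h0, Complex.ofReal_zero, mul_zero]
      · exact fderiv_mul ((hb.contDiffAt (hW.mem_nhds hw)).differentiableAt (by simp))
          (hkC.differentiable (by simp) w)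
      · rw [(hz w fun hw' => hw (hks hw')).fderiv_eq]
        exact fderiv_const_apply _
    obtain ⟨a1, a2, a3, a4⟩ := hprod a ha
    obtain ⟨c1, c2, c3, c4⟩ := hprod c hc
    set pa := fderiv ℝ fun w => a w * (k w : ℂ) with hpa
    set pc := fderiv ℝ fun w => c w * (k w : ℂ) with hpc
    have ia : Integrable pa := (a1.continuous_fderiv (by simp)).integrable_of_hasCompactSupport
      (a2.fderiv ℝ)
    have ic : Integrable pc := (c1.continuous_fderiv (by simp)).integrable_of_hasCompactSupport
      (c2.fderiv ℝ)
    have h1 : ∫ w, (linDzbar (pa w) + linDz (pc w)) = 0 := by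
      rw [integral_add (linDzbar.integrable_comp ia) (linDz.integrable_comp ic),
        linDzbar.integral_comp_comm ia, linDz.integral_comp_comm ic, hpa, hpc,
        integral_fderiv_eq_zero (a1.of_le (by simp)) a2,
        integral_fderiv_eq_zero (c1.of_le (by simp)) c2]
      simp
    have h2 : ∫ w in W, (linDzbar (pa w) + linDz (pc w)) = 0 := by
      rw [← h1]
      refine setIntegral_eq_integral_of_forall_compl_eq_zero fun w hw => ?_
      rw [a4 w hw, c4 w hw, map_zero, map_zero, add_zero]
    -- By the product rule `k R = (a k)_z̄ + (c k)_z - (a k_z̄ + c k_z)`. The first two terms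
    -- integrate to zero by compact support, the bracket by hypothesis.
    have h3 : ∫ w in W, k w • R w = 0 := by
      have hint1 : IntegrableOn (fun w => linDzbar (pa w) + linDz (pc w)) W :=
        ((linDzbar.integrable_comp ia).add (linDz.integrable_comp ic)).integrableOn
      have e : EqOn (fun w => k w • R w) (fun w => (linDzbar (pa w) + linDz (pc w))
          - (a w * linDzbar (fderiv ℝ (fun w => (k w : ℂ)) w)
            + c w * linDz (fderiv ℝ (fun w => (k w : ℂ)) w))) W := by
        intro w hw
        simp only [hR]
        rw [a3 w hw, c3 w hw, map_add, map_add, linDz_mul_smul, linDz_mul_smul,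
          linDzbar_mul_smul, linDzbar_mul_smul, Complex.real_smul]
        ring
      have hkR : IntegrableOn (fun w => k w • R w) W := by
        have hcR : Continuous fun w => k w • R w := by
          refine continuous_iff_continuousAt.2 fun w => ?_
          by_cases hw : w ∈ tsupport k
          · exact hk.continuous.continuousAt.smul (hRc.continuousAt (hW.mem_nhds (hks hw)))
          · refine (continuousAt_const (y := (0 : ℂ))).congr ?_
            filter_upwards [(isClosed_tsupport k).isOpen_compl.mem_nhds hw] with w' hw'
            rw [image_eq_zero_of_notMem_tsupport hw', zero_smul]
        exact (hcR.integrable_of_hasCompactSupport hkc.smul_right).integrableOn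
      have hint2 : IntegrableOn (fun w => a w * linDzbar (fderiv ℝ (fun w => (k w : ℂ)) w)
            + c w * linDz (fderiv ℝ (fun w => (k w : ℂ)) w)) W := by
        refine (hint1.sub hkR).congr_fun (fun w hw => ?_) hW.measurableSet
        have := e hw
        simp only [Pi.sub_apply] at this ⊢
        rw [this]
        ring
      rw [setIntegral_congr_fun hW.measurableSet e, integral_sub hint1 hint2, h2,
        h k hk hkc hks, sub_zero]
    rw [← h3]
    refine (setIntegral_eq_integral_of_forall_compl_eq_zero fun w hw => ?_).symm
    rw [image_eq_zero_of_notMem_tsupport fun h => hw (hks h), zero_smul]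
  have := (volume : Measure ℂ).eqOn_open_of_ae_eq (U := W) (f := R) (g := fun _ => 0)
    ((ae_restrict_iff' hW.measurableSet).2 hae) hW hRc continuousOn_const
  exact fun w hw => this hw

variable {H : Type*} [TopologicalSpace H] {I : ModelWithCorners ℝ (EuclideanSpace ℝ (Fin 2)) H}
  {M : Type*} [TopologicalSpace M] [ChartedSpace H M] [IsManifold I ∞ M]

/-- A continuous function on `M` vanishes if it vanishes at some point of each planar chart. -/
theorem eq_zero_of_planarCharts {z : M → ℂ} (hz : IsPlanarImmersion I z) {u : M → ℂ}
    (hu : Continuous u)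
    (h : ∀ W σ, IsPlanarChart I z W σ → ∀ w ∈ W, u (σ w) = 0) (x : M) : u x = 0 := by
  by_contra hx
  obtain ⟨W, σ, hσ, ⟨w, hw⟩, hmaps⟩ := exists_isPlanarChart hz
    (isOpen_ne_fun hu (continuous_const (y := (0 : ℂ)))) ⟨x, hx⟩
  exact hmaps hw (h W σ hσ w hw)

/-- In a planar chart this is the symmetry of the second derivative. It extends to the boundary by
continuity, as planar charts are dense. -/
theorem dzbar_dz_comm {z : M → ℂ} (hz : IsPlanarImmersion I z) {u : M → ℂ}
    (hu : ContMDiff I 𝓘(ℝ, ℂ) ∞ u) (x : M) :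
    dzbar I z (dz I z u) x = dz I z (dzbar I z u) x := by
  have h1 := contMDiff_dz hz hu
  have h2 := contMDiff_dzbar hz hu
  refine sub_eq_zero.1 (eq_zero_of_planarCharts hz (u := fun x => dzbar I z (dz I z u) x
    - dz I z (dzbar I z u) x) ((contMDiff_dzbar hz h1).continuous.sub
      (contMDiff_dz hz h2).continuous) (fun W σ hσ w hw => ?_) x)
  have hc := hσ.contDiffOn u hu
  have hd : DifferentiableAt ℝ (fderiv ℝ (u ∘ σ)) w :=
    ((hc.fderiv_of_isOpen (m := ∞) hσ.isOpen (by simp)).contDiffAt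
      (hσ.isOpen.mem_nhds hw)).differentiableAt (by simp)
  have e1 : dz I z u ∘ σ =ᶠ[𝓝 w] fun w => linDz (fderiv ℝ (u ∘ σ) w) := by
    filter_upwards [hσ.isOpen.mem_nhds hw] with w' hw'
    rw [Function.comp_apply, dz_eq_linDz, hσ.relDeriv_eq hz hu hw']
  have e2 : dzbar I z u ∘ σ =ᶠ[𝓝 w] fun w => linDzbar (fderiv ℝ (u ∘ σ) w) := by
    filter_upwards [hσ.isOpen.mem_nhds hw] with w' hw'
    rw [Function.comp_apply, dzbar_eq_linDzbar, hσ.relDeriv_eq hz hu hw']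
  have f1 : fderiv ℝ (fun w => linDz (fderiv ℝ (u ∘ σ) w)) w
      = linDz.comp (fderiv ℝ (fderiv ℝ (u ∘ σ)) w) :=
    (linDz.hasFDerivAt.comp w hd.hasFDerivAt).fderiv
  have f2 : fderiv ℝ (fun w => linDzbar (fderiv ℝ (u ∘ σ) w)) w
      = linDzbar.comp (fderiv ℝ (fderiv ℝ (u ∘ σ)) w) :=
    (linDzbar.hasFDerivAt.comp w hd.hasFDerivAt).fderiv
  have hsymm : IsSymmSndFDerivAt ℝ (u ∘ σ) w :=
    (hc.contDiffAt (hσ.isOpen.mem_nhds hw)).isSymmSndFDerivAt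
      (by rw [minSmoothness_of_isRCLikeNormedField]; exact WithTop.coe_le_coe.2 (le_top : (2 : ℕ∞) ≤ ⊤))
  rw [dzbar_eq_linDzbar, dz_eq_linDz, hσ.relDeriv_eq hz h1 hw, hσ.relDeriv_eq hz h2 hw,
    e1.fderiv_eq, e2.fderiv_eq, f1, f2, linDzbar_linDz_comm (hsymm.eq _ _), sub_self]

omit [IsManifold I ∞ M] in
/-- Test functions in a planar chart extend to smooth functions on `M`. -/
theorem exists_extension {z : M → ℂ} (hz : IsPlanarImmersion I z) [T2Space M] {W : Set ℂ}
    {σ : ℂ → M} (hσ : IsPlanarChart I z W σ) {k : ℂ → ℂ} (hk : ContDiff ℝ ∞ k)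
    (hkc : HasCompactSupport k) (hks : tsupport k ⊆ W) :
    ∃ K : M → ℂ, ContMDiff I 𝓘(ℝ, ℂ) ∞ K ∧
      (∀ w ∈ W, relDeriv I z K (σ w) = fderiv ℝ k w) ∧ ∀ x ∉ σ '' W, relDeriv I z K x = 0 := by
  classical
  let K : M → ℂ := (σ '' W).indicator fun x => k (z x)
  have h1 : ∀ x ∈ σ '' W, K =ᶠ[𝓝 x] fun x => k (z x) := fun x hx => by
    filter_upwards [hσ.isOpen_image.mem_nhds hx] with y hy
    exact indicator_of_mem hy _
  -- A compact subset of the Hausdorff space `M` is closed, so the extension by zero is smooth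
  -- across the edge of the chart.
  have hclosed : IsClosed (σ '' tsupport k) :=
    (hkc.isCompact.image_of_continuousOn (hσ.continuousOn.mono hks)).isClosed
  have h2 : ∀ x ∉ σ '' tsupport k, K =ᶠ[𝓝 x] fun _ => 0 := fun x hx => by
    filter_upwards [hclosed.isOpen_compl.mem_nhds hx] with y hy
    by_cases hyW : y ∈ σ '' W
    · have h3 := hσ.section_apply_of_mem hyW
      have h4 : z y ∉ tsupport k := fun h => hy ⟨z y, h, h3.1⟩
      exact (indicator_of_mem hyW _).trans (image_eq_zero_of_notMem_tsupport h4)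
    · exact indicator_of_notMem hyW _
  have hsub : σ '' tsupport k ⊆ σ '' W := image_mono hks
  refine ⟨K, fun x => ?_, fun w hw => ?_, fun x hx => ?_⟩
  · by_cases hx : x ∈ σ '' W
    · exact (hk.contMDiff.comp hz.smooth x).congr_of_eventuallyEq (h1 x hx)
    · exact contMDiffAt_const.congr_of_eventuallyEq (h2 x fun h => hx (hsub h))
  · have h3 := relDeriv_of_eventuallyEq_comp hz (g := k) (hk.differentiable (by simp) _)
      (h1 (σ w) (mem_image_of_mem σ hw))
    rwa [hσ.section_apply w hw] at h3
  · rw [relDeriv_congr (h2 x fun h => hx (hsub h)), relDeriv, differential_const]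
    exact ContinuousLinearMap.zero_comp _

/-- The Euler-Lagrange equation in the interior, extended to `M` by continuity. -/
theorem dzbar_add_dz_eq_zero [T2Space M] [PolishSpace M] [MeasurableSpace M] [BorelSpace M]
    {z : M → ℂ} (hz : IsPlanarImmersion I z) {a c : M → ℂ} (ha : ContMDiff I 𝓘(ℝ, ℂ) ∞ a)
    (hc : ContMDiff I 𝓘(ℝ, ℂ) ∞ c)
    (h : ∀ k : M → ℂ, ContMDiff I 𝓘(ℝ, ℂ) ∞ k →
      ∫ x, (conj (a x) * dz I z k x + conj (c x) * dzbar I z k x) ∂(pullbackArea z) = 0) (x : M) :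
    dzbar I z a x + dz I z c x = 0 := by
  refine eq_zero_of_planarCharts hz (u := fun x => dzbar I z a x + dz I z c x)
    ((contMDiff_dzbar hz ha).continuous.add (contMDiff_dz hz hc).continuous)
    (fun W σ hσ w hw => ?_) x
  rw [dzbar_eq_linDzbar, dz_eq_linDz, hσ.relDeriv_eq hz ha hw, hσ.relDeriv_eq hz hc hw]
  refine linDzbar_add_linDz_eq_zero_of_integral hσ.isOpen (hσ.contDiffOn a ha)
    (hσ.contDiffOn c hc) (fun k hk hkc hks => ?_) w hw
  have hkC : ContDiff ℝ ∞ fun w => (k w : ℂ) := Complex.ofRealCLM.contDiff.comp hk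
  have hts : tsupport (fun w => (k w : ℂ)) ⊆ tsupport k :=
    closure_mono fun w hw h0 => hw (by simp only [h0, Complex.ofReal_zero])
  obtain ⟨K, hK, hKW, hK0⟩ := exists_extension hz hσ hkC
    (hkc.comp_left Complex.ofReal_zero) (hts.trans hks)
  have hreal : ∀ w v, (fderiv ℝ (fun w => (k w : ℂ)) w v).im = 0 := fun w v => by
    have := (Complex.ofRealCLM.hasFDerivAt.comp w (hk.differentiable (by simp) w).hasFDerivAt).fderiv
    have h2 : fderiv ℝ (fun w => (k w : ℂ)) w = _ := this
    rw [h2]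
    simp
  set F : M → ℂ := fun x => conj (a x) * dz I z K x + conj (c x) * dzbar I z K x with hF
  have hFc : Continuous F := by
    have h1 := (contMDiff_dz hz hK).continuous
    have h2 := (contMDiff_dzbar hz hK).continuous
    have h3 := ha.continuous
    have h4 := hc.continuous
    fun_prop
  have h1 : ∫ x in σ '' W, F x ∂(pullbackArea z) = 0 := by
    rw [← h K hK]
    refine setIntegral_eq_integral_of_forall_compl_eq_zero fun x hx => ?_
    simp only [hF, dz_eq_linDz, dzbar_eq_linDzbar, hK0 x hx, map_zero, mul_zero, add_zero]
  rw [hσ.setIntegral_eq hz.smooth.continuous hz.locally_injective hFc] at h1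
  -- For real `k` the conjugate of `k_z` is `k_z̄`. Conjugating the integral turns the pairing with
  -- `conj a`, `conj c` into the bilinear one with `a k_z̄ + c k_z`.
  have h2 := congrArg conj h1
  rw [map_zero, ← integral_conj] at h2
  rw [← h2]
  refine setIntegral_congr_fun hσ.isOpen.measurableSet fun w hw => ?_
  have h3 := conj_linDz_of_real (hreal w)
  have h4 : conj (linDzbar (fderiv ℝ (fun w => (k w : ℂ)) w))
      = linDz (fderiv ℝ (fun w => (k w : ℂ)) w) := by
    rw [← h3, Complex.conj_conj]
  simp only [hF, dz_eq_linDz, dzbar_eq_linDzbar, hKW w hw, map_add, map_mul, Complex.conj_conj,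
    Function.comp_apply, h3, h4]

end EulerLagrange

end FreeBoundary

namespace FreeBoundary

/-! ### Logarithm, sign of the integrand, and vanishing -/

section Rigidity

theorem linDz_id : linDz (ContinuousLinearMap.id ℝ ℂ) = 1 := by
  simp [linDz_apply]

theorem linDzbar_id : linDzbar (ContinuousLinearMap.id ℝ ℂ) = 0 := by
  simp [linDzbar_apply]

variable {H : Type*} [TopologicalSpace H] {I : ModelWithCorners ℝ (EuclideanSpace ℝ (Fin 2)) H}
  {M : Type*} [TopologicalSpace M] [ChartedSpace H M]

/-- A smooth nowhere vanishing function on a simply connected manifold has a smooth logarithm. -/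
theorem exists_smooth_log [SimplyConnectedSpace M] {φ : M → ℂ}
    (hφ : ContMDiff I 𝓘(ℝ, ℂ) ∞ φ) (h0 : ∀ x, φ x ≠ 0) :
    ∃ L : M → ℂ, ContMDiff I 𝓘(ℝ, ℂ) ∞ L ∧ ∀ x, Complex.exp (L x) = φ x := by
  have := locallyPathConnectedSpace_of_modelWithCorners I M
  obtain ⟨x₀⟩ : Nonempty M := inferInstance
  obtain ⟨L, ⟨-, hL⟩, -⟩ := Complex.isCoveringMapOn_exp.existsUnique_continuousMap_lifts
    ⟨φ, hφ.continuous⟩ (a₀ := x₀) (e₀ := Complex.log (φ x₀)) (Complex.exp_log (h0 x₀))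
    (fun x => h0 x)
  have hexp : ∀ x, Complex.exp (L x) = φ x := fun x => congrFun hL x
  refine ⟨L, fun x => ?_, hexp⟩
  -- The continuous lift `L` is smooth because near `x` it differs by the constant `L x` from the
  -- principal logarithm of `φ y / φ x`, a quotient close to `1`.
  have hev : ∀ᶠ y in 𝓝 x, |(L y - L x).im| < Real.pi := by
    have hc : Continuous fun y => |(L y - L x).im| := by fun_prop
    exact hc.continuousAt.eventually_lt_const (by simpa using Real.pi_pos)
  have hloc : (L : M → ℂ) =ᶠ[𝓝 x] fun y => L x + Complex.log (φ y / φ x) := by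
    filter_upwards [hev] with y hy
    rw [← hexp y, ← hexp x, ← Complex.exp_sub,
      Complex.log_exp (abs_lt.1 hy).1 (abs_lt.1 hy).2.le]
    ring
  have hg : ContDiffAt ℝ ∞ (fun w : ℂ => L x + Complex.log (w / φ x)) (φ x) := by
    have h1 : ContDiffAt ℝ ∞ Complex.log (φ x / φ x) := by
      rw [div_self (h0 x)]
      exact (Complex.contDiffAt_log Complex.one_mem_slitPlane).restrict_scalars ℝ
    have h2 : ContDiffAt ℝ ∞ (fun w : ℂ => Complex.log (w / φ x)) (φ x) :=
      ContDiffAt.comp (g := Complex.log) (f := fun w => w / φ x) (φ x) h1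
        (contDiffAt_id.div_const (φ x))
    exact contDiffAt_const.add h2
  exact (hg.contMDiffAt.comp x (hφ x)).congr_of_eventuallyEq hloc

theorem relDeriv_exp {z : M → ℂ} {L : M → ℂ} (hL : ContMDiff I 𝓘(ℝ, ℂ) ∞ L) (x : M) :
    relDeriv I z (fun x => Complex.exp (L x)) x = Complex.exp (L x) • relDeriv I z L x := by
  have hd : HasFDerivAt Complex.exp
      ((ContinuousLinearMap.toSpanSingleton ℂ (Complex.exp (L x))).restrictScalars ℝ) (L x) :=
    (Complex.hasDerivAt_exp (L x)).hasFDerivAt.restrictScalars ℝ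
  rw [relDeriv_comp hd.differentiableAt (smooth_mdifferentiableAt hL x), hd.fderiv]
  ext w
  simp [mul_comm]

theorem differential_eq_zero_of_dz_dzbar {z : M → ℂ} (hz : IsPlanarImmersion I z) {u : M → ℂ}
    {x : M} (h1 : dz I z u x = 0) (h2 : dzbar I z u x = 0) : differential I u x = 0 := by
  ext v
  rw [differential_eq_dz_add_dzbar I u (hz.injective_differential x), h1, h2]
  simp

/-- The sign of `V'` at `|w|²` is the sign of `log |(1 + V'(|w|²)) w|`. -/
theorem deriv_mul_log_nonneg {V : ℝ → ℝ} (hV : IsElasticPotential V) {r : ℝ} (hr : 0 < r)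
    (hpos : 0 < 1 + deriv V (r ^ 2)) :
    0 ≤ deriv V (r ^ 2) * Real.log ((1 + deriv V (r ^ 2)) * r) ∧
      (deriv V (r ^ 2) * Real.log ((1 + deriv V (r ^ 2)) * r) = 0 → r = 1) := by
  have hr2 : (r ^ 2) ∈ Ioi (0 : ℝ) := pow_pos hr 2
  have h1 : (1 : ℝ) ∈ Ioi (0 : ℝ) := mem_Ioi.2 one_pos
  -- `V'` is strictly increasing and vanishes at `1`, so for `r ≠ 1` both factors `1 + V'(r²)` and
  -- `r` lie on the same side of `1`.
  rcases lt_trichotomy r 1 with h | rfl | h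
  · have hd : deriv V (r ^ 2) < 0 := by
      rw [← hV.deriv_one]
      exact hV.strictMonoOn_deriv hr2 h1 (by nlinarith)
    have hl : Real.log ((1 + deriv V (r ^ 2)) * r) < 0 :=
      Real.log_neg (mul_pos hpos hr) (by nlinarith)
    have := mul_pos_of_neg_of_neg hd hl
    exact ⟨this.le, fun h0 => absurd h0 this.ne'⟩
  · simp [hV.deriv_one]
  · have hd : 0 < deriv V (r ^ 2) := by
      rw [← hV.deriv_one]
      exact hV.strictMonoOn_deriv h1 hr2 (by nlinarith)
    have hl : 0 < Real.log ((1 + deriv V (r ^ 2)) * r) := Real.log_pos (by nlinarith)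
    have := mul_pos hd hl
    exact ⟨this.le, fun h0 => absurd h0 this.ne'⟩

variable [IsManifold I ∞ M]

theorem contMDiff_deriv_mul_dz {V : ℝ → ℝ} (hV : IsElasticPotential V) {z f : M → ℂ}
    (hz : IsPlanarImmersion I z) (hf : IsOrientationPreservingImmersion I z f) :
    ContMDiff I 𝓘(ℝ, ℂ) ∞ fun x =>
      ((deriv V (‖dz I z f x‖ ^ 2) : ℝ) : ℂ) * dz I z f x := by
  intro x
  have hne := dz_ne_zero hf x
  have hΘ : ContDiffAt ℝ ∞ (fun w : ℂ => ((deriv V (‖w‖ ^ 2) : ℝ) : ℂ) * w) (dz I z f x) := by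
    have h1 : ContDiffAt ℝ ∞ (deriv V) (‖dz I z f x‖ ^ 2) :=
      hV.contDiffOn_deriv.contDiffAt (Ioi_mem_nhds (pow_pos (norm_pos_iff.2 hne) 2))
    have h2 : ContDiffAt ℝ ∞ (fun w : ℂ => deriv V (‖w‖ ^ 2)) (dz I z f x) :=
      h1.comp (dz I z f x) (contDiff_norm_sq ℝ).contDiffAt
    exact (Complex.ofRealCLM.contDiff.contDiffAt.comp _ h2).mul contDiffAt_id
  exact hΘ.contMDiffAt.comp x (contMDiff_dz hz hf.immersion.smooth x)

/-- A continuous nonnegative real function on `M` with zero integral vanishes. -/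
theorem eq_zero_of_integral_eq_zero [CompactSpace M] [PolishSpace M] [MeasurableSpace M]
    [BorelSpace M] {z : M → ℂ} (hz : IsPlanarImmersion I z) {u : M → ℝ} (hu : Continuous u)
    (h0 : ∀ x, 0 ≤ u x) (h : ∫ x, u x ∂(pullbackArea z) = 0) (x : M) : u x = 0 := by
  have := isFiniteMeasure_pullbackArea hz
  have := isOpenPosMeasure_pullbackArea hz
  obtain ⟨C, hC⟩ := isCompact_univ.exists_bound_of_continuousOn hu.continuousOn
  have hi : Integrable u (pullbackArea z) := Integrable.of_bound hu.aestronglyMeasurable C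
    (Eventually.of_forall fun x => hC x (mem_univ x))
  have hae := (integral_eq_zero_iff_of_nonneg h0 hi).1 h
  exact congrFun (Measure.eq_of_ae_eq hae hu continuous_const) x

end Rigidity

end FreeBoundary

/-! ### The rigidity theorem -/

theorem mainTheorem1 {H : Type*} [TopologicalSpace H]
    (I : ModelWithCorners ℝ (EuclideanSpace ℝ (Fin 2)) H)
    {M : Type*} [TopologicalSpace M] [ChartedSpace H M] [IsManifold I ∞ M]
    [T2Space M] [CompactSpace M] [SimplyConnectedSpace M]
    [MeasurableSpace M] [BorelSpace M]
    (V : ℝ → ℝ) (hV : FreeBoundary.IsElasticPotential V)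
    (z : M → ℂ) (hz : FreeBoundary.IsPlanarImmersion I z)
    (f : M → ℂ) (hf : FreeBoundary.IsOrientationPreservingImmersion I z f)
    (hcrit : FreeBoundary.IsCriticalForAllVariations I V z f)
    (hpos : ∀ x : M, 0 < 1 + deriv V (‖FreeBoundary.dz I z f x‖ ^ 2)) :
    ∃ a b : ℂ, ‖a‖ = 1 ∧ ∀ x : M, f x = a * z x + b := by
  open FreeBoundary in
  have : PolishSpace M := polishSpace_of_compact I
  have hfs := hf.immersion.smooth
  have hvar := fun (h : M → ℂ) (hh : ContMDiff I 𝓘(ℝ, ℂ) ∞ h) =>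
    integral_first_variation_eq_zero hV hz hf hcrit hh
  have hg := contMDiff_deriv_mul_dz hV hz hf
  have hdz := contMDiff_dz hz hfs
  have hdzb := contMDiff_dzbar hz hfs
  -- the stress `φ = (1 + V'(|f_z|²)) f_z` is holomorphic
  let φ : M → ℂ := fun x =>
    ((deriv V (‖dz I z f x‖ ^ 2) : ℝ) : ℂ) * dz I z f x + dz I z f x
  have hφ : ContMDiff I 𝓘(ℝ, ℂ) ∞ φ := hg.add hdz
  have hφ' : ∀ x, φ x = ((1 + deriv V (‖dz I z f x‖ ^ 2) : ℝ) : ℂ) * dz I z f x := fun x => by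
    simp only [φ]
    push_cast
    ring
  have hφ0 : ∀ x, φ x ≠ 0 := fun x => by
    rw [hφ']
    exact mul_ne_zero (Complex.ofReal_ne_zero.2 (hpos x).ne') (dz_ne_zero hf x)
  -- Since `(f_z)_z̄ = (f_z̄)_z`, the derivative `φ_z̄` is exactly the left side of the
  -- Euler-Lagrange equation.
  have hφbar : ∀ x, dzbar I z φ x = 0 := fun x => by
    rw [dzbar_eq_linDzbar, relDeriv_add z (smooth_mdifferentiableAt hg x)
      (smooth_mdifferentiableAt hdz x), map_add, ← dzbar_eq_linDzbar, ← dzbar_eq_linDzbar,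
      dzbar_dz_comm hz hfs]
    exact dzbar_add_dz_eq_zero hz hg hdzb hvar x
  -- its logarithm and the variation with derivative `φ log φ`
  obtain ⟨L, hL, hexp⟩ := exists_smooth_log hφ hφ0
  have hLbar : ∀ x, dzbar I z L x = 0 := fun x => by
    have h1 := hφbar x
    rw [← funext hexp, dzbar_eq_linDzbar, relDeriv_exp hL, linDzbar_mul_smul,
      ← dzbar_eq_linDzbar] at h1
    exact (mul_eq_zero.1 h1).resolve_left (Complex.exp_ne_zero _)
  have hψbar : ∀ x, dzbar I z (fun x => φ x * L x) x = 0 := fun x => by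
    rw [dzbar_eq_linDzbar, relDeriv_mul z (smooth_mdifferentiableAt hφ x)
      (smooth_mdifferentiableAt hL x), map_add, linDzbar_mul_smul, linDzbar_mul_smul,
      ← dzbar_eq_linDzbar, ← dzbar_eq_linDzbar, hφbar, hLbar]
    ring
  obtain ⟨h, hh, hhd⟩ := exists_primitive hz (smooth_mul hφ hL) hψbar
  have hrel : ∀ x, relDeriv I z h x = (φ x * L x) • ContinuousLinearMap.id ℝ ℂ := fun x =>
    relDeriv_eq_of_differential_eq_comp hz (by rw [hhd]; rfl)
  have hLre : ∀ x, (L x).re = Real.log ((1 + deriv V (‖dz I z f x‖ ^ 2)) * ‖dz I z f x‖) := by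
    intro x
    have h1 : Real.exp (L x).re = (1 + deriv V (‖dz I z f x‖ ^ 2)) * ‖dz I z f x‖ := by
      rw [← Complex.norm_exp, hexp, hφ', norm_mul, Complex.norm_real, Real.norm_eq_abs,
        abs_of_pos (hpos x)]
    rw [← h1, Real.log_exp]
  have hnorm : ∀ x, ‖dz I z f x‖ = 1 := by
    -- `u` is the real part of `conj(V' f_z) φ L`, the first-variation integrand for the primitive
    -- `h` of `φ L`.
    let u : M → ℝ := fun x => (1 + deriv V (‖dz I z f x‖ ^ 2)) * ‖dz I z f x‖ ^ 2 *
      (deriv V (‖dz I z f x‖ ^ 2) * (L x).re)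
    have hr : ∀ x, 0 < ‖dz I z f x‖ := fun x => norm_pos_iff.2 (dz_ne_zero hf x)
    have hVc : Continuous fun x => deriv V (‖dz I z f x‖ ^ 2) :=
      hV.contDiffOn_deriv.continuousOn.comp_continuous (hdz.continuous.norm.pow 2)
        fun x => pow_pos (hr x) 2
    have hLc := hL.continuous
    have hdzc := hdz.continuous
    have huc : Continuous u := by fun_prop
    have hu0 : ∀ x, 0 ≤ u x := fun x => by
      have h1 := (deriv_mul_log_nonneg hV (hr x) (hpos x)).1
      rw [← hLre] at h1
      exact mul_nonneg (mul_nonneg (hpos x).le (by positivity)) h1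
    have hFc : Continuous fun x => conj (((deriv V (‖dz I z f x‖ ^ 2) : ℝ) : ℂ) * dz I z f x)
        * (φ x * L x) := by
      have h1 := hφ.continuous
      fun_prop
    have hint : ∫ x, u x ∂(pullbackArea z) = 0 := by
      have := isFiniteMeasure_pullbackArea hz
      have h1 := hvar h hh
      simp only [dz_eq_linDz z h, dzbar_eq_linDzbar z h, hrel, linDz_mul_smul,
        linDzbar_mul_smul] at h1
      simp only [linDz_id, linDzbar_id, mul_one, mul_zero, add_zero] at h1
      obtain ⟨C, hC⟩ := isCompact_univ.exists_bound_of_continuousOn hFc.continuousOn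
      have hi := Integrable.of_bound (μ := pullbackArea z) hFc.aestronglyMeasurable C
        (Eventually.of_forall fun x => hC x (mem_univ x))
      have h2 := integral_re hi
      rw [h1, map_zero] at h2
      rw [← h2]
      refine integral_congr_ae (Eventually.of_forall fun x => ?_)
      have h3 : conj (((deriv V (‖dz I z f x‖ ^ 2) : ℝ) : ℂ) * dz I z f x) * (φ x * L x)
          = (((1 + deriv V (‖dz I z f x‖ ^ 2)) * ‖dz I z f x‖ ^ 2 *
            deriv V (‖dz I z f x‖ ^ 2) : ℝ) : ℂ) * L x := by
        have h4 := Complex.conj_mul' (dz I z f x)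
        rw [hφ', map_mul, Complex.conj_ofReal]
        push_cast
        linear_combination (((deriv V (‖dz I z f x‖ ^ 2) : ℝ) : ℂ) *
          (1 + ((deriv V (‖dz I z f x‖ ^ 2) : ℝ) : ℂ)) * L x) * h4
      simp only [u]
      rw [h3, RCLike.re_eq_complex_re, Complex.re_ofReal_mul]
      ring
    intro x
    have h1 := eq_zero_of_integral_eq_zero hz huc hu0 hint x
    have h2 := (mul_eq_zero.1 h1).resolve_left (mul_pos (hpos x) (pow_pos (hr x) 2)).ne'
    rw [hLre] at h2
    exact (deriv_mul_log_nonneg hV (hr x) (hpos x)).2 h2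
  have hV1 : ∀ x, deriv V (‖dz I z f x‖ ^ 2) = 0 := fun x => by
    rw [hnorm, one_pow, hV.deriv_one]
  -- `f_z` is constant
  have hLconst : ∀ x, differential I L x = 0 := fun x => by
    refine differential_eq_zero_of_dz_dzbar hz ?_ (hLbar x)
    have hmd := smooth_mdifferentiableAt hL x
    -- `Re L = log |φ| = 0`, so `conj L = -L`. Differentiating gives `conj (L_z w) = -L_z w` for all
    -- `w`; the choices `w = 1` and `w = i` together force `L_z = 0`.
    have h1 : (fun y => conj (L y)) = fun y => (-1 : ℂ) * L y := funext fun y => by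
      have h2 : (L y).re = 0 := by rw [hLre, hV1, hnorm]; simp
      exact Complex.ext (by simp [h2]) (by simp)
    have h3 := relDeriv_comp (z := z) (g := fun w => conj w)
      Complex.conjCLE.differentiableAt hmd
    have h4 : fderiv ℝ (fun w : ℂ => conj w) (L x) = Complex.conjCLE :=
      Complex.conjCLE.fderiv
    rw [h1, relDeriv_const_mul z _ hmd, h4] at h3
    have h5 : ∀ w, -(dz I z L x * w) = conj (dz I z L x * w) := fun w => by
      have h6 := DFunLike.congr_fun h3 w
      have h7 : relDeriv I z L x w = dz I z L x * w := by
        rw [apply_eq_linDz_add_linDzbar, ← dz_eq_linDz, ← dzbar_eq_linDzbar, hLbar]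
        ring
      rw [← h7]
      simpa using h6
    have h8 := h5 1
    have h9 := h5 Complex.I
    rw [mul_one] at h8
    rw [map_mul, ← h8, Complex.conj_I] at h9
    have h10 : (2 * Complex.I) * dz I z L x = 0 := by linear_combination -h9
    exact (mul_eq_zero.1 h10).resolve_left (by simp)
  obtain ⟨x₀⟩ : Nonempty M := inferInstance
  have ha : ∀ x, dz I z f x = dz I z f x₀ := fun x => by
    have h1 : ∀ x, dz I z f x = φ x := fun x => by
      simp only [φ, hV1, Complex.ofReal_zero, zero_mul, zero_add]
    rw [h1, h1, ← hexp, ← hexp, eq_of_differential_eq_zero hL hLconst x x₀]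
  -- `f_z̄` vanishes
  have hbar : ∀ x, dzbar I z f x = 0 := by
    -- With `V' = 0`, the variation in the direction of `f` itself leaves only `∫ |f_z̄|²`.
    have h1 := hvar f hfs
    simp only [hV1, Complex.ofReal_zero, zero_mul, map_zero, zero_add] at h1
    have h2 : ∀ x, conj (dzbar I z f x) * dzbar I z f x = ((‖dzbar I z f x‖ ^ 2 : ℝ) : ℂ) :=
      fun x => by rw [Complex.conj_mul']; push_cast; rfl
    simp only [h2] at h1
    rw [integral_complex_ofReal, Complex.ofReal_eq_zero] at h1
    intro x
    have h3 := eq_zero_of_integral_eq_zero hz (hdzb.continuous.norm.pow 2)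
      (fun x => sq_nonneg _) h1 x
    simpa using h3
  -- hence `f - f_z z` is constant
  have hd : ContMDiff I 𝓘(ℝ, ℂ) ∞ fun x => f x + -dz I z f x₀ * z x :=
    hfs.add (smooth_mul contMDiff_const hz.smooth)
  have hd0 : ∀ x, differential I (fun x => f x + -dz I z f x₀ * z x) x = 0 := fun x => by
    have h1 : relDeriv I z (fun x => f x + -dz I z f x₀ * z x) x
        = relDeriv I z f x + -dz I z f x₀ • ContinuousLinearMap.id ℝ ℂ := by
      rw [relDeriv_add z (smooth_mdifferentiableAt hfs x) (smooth_mdifferentiableAt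
        (smooth_mul contMDiff_const hz.smooth) x), relDeriv_const_mul z _
        (smooth_mdifferentiableAt hz.smooth x), relDeriv_self hz]
    refine differential_eq_zero_of_dz_dzbar hz ?_ ?_
    · rw [dz_eq_linDz, h1, map_add, linDz_mul_smul, linDz_id, ← dz_eq_linDz, ha x]
      ring
    · rw [dzbar_eq_linDzbar, h1, map_add, linDzbar_mul_smul, linDzbar_id, ← dzbar_eq_linDzbar,
        hbar x]
      ring
  refine ⟨dz I z f x₀, f x₀ + -dz I z f x₀ * z x₀, hnorm x₀, fun x => ?_⟩
  have h1 := eq_of_differential_eq_zero hd hd0 x x₀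
  linear_combination h1
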